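/- Let $m,d\in\mathbb N$, $T>0$, $\gamma\in(1/2,1)$, $\kappa\in(0,1)$ with $\gamma(1+\kappa)<1$ and $\gamma+\kappa>1$. Let $\sigma^1,\dots,\sigma^d:\mathbb R^m\to\mathbb R^m$, $x:[0,T]\to\mathbb R^d$ and $a\in\mathbb R^m\setminus\{0\}$ be such that: (1) for every $j$: $\sigma^j(0)=0$; there are constants $N<\infty$ and $c>0$ such that $|\sigma^j(\xi_2)-\sigma^j(\xi_1)|\le N\,\big||\xi_2|^\kappa-|\xi_1|^\kappa\big|$ for all $\xi_1,\xi_2\in\mathbb R^m$, and $|\sigma^j(\xi)|\ge c|\xi|^\kappa$ for all $\xi\in\mathbb R^m$; and $\sigma^j$ is differentiable on $\{\xi\ne0\}$ with $\nabla\sigma^j$ locally Hölder continuous there of some order larger than $\frac1\gamma-1$; (2) there is $\varepsilon_1>0$ such that $x$ is Hölder continuous of order $\gamma+\varepsilon_1$ on $[0,T]$ and $\gamma+\varepsilon_1+\gamma\kappa<1$; (3) ($x$ is Hölder rough) for some $\hat\varepsilon>0$ there is $c>0$ such that for every $s\in[0,T]$, every $\epsilon\in(0,T/2]$ and every $\phi\in\mathbb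 R^d$ with $|\phi|=1$ there is $t\in[0,T]$ with $\epsilon/2<|t-s|<\epsilon$ and $|\langle\phi,x_t-x_s\rangle|>c\,\epsilon^{\gamma+\hat\varepsilon}$. Consider the equation $$y_t=a+\sum_{j=1}^d\int_0^t\sigma^j(y_u)\,dx^j_u,\qquad t\in[0,T].\qquad(*)$$ Then there exist a continuous $y:[0,T]\to\mathbb R^m$ and $\tau\le T$ such that one of the following holds. (A) $\tau=T$, $y$ does not vanish on $[0,T]$, $y\in\mathcal C^\gamma([0,T];\mathbb R^m)$, and $y$ solves $(*)$ on $[0,T]$ with the integrals understood in the usual Young sense. (B) $0<\tau\le T$, $y\in\mathcal C^\gamma([0,T];\mathbb R^m)$, $y_s\neq0$ for $s\in[0,\tau)$, $\lim_{t\uparrow\tau}y_t=0$, $y_t=0$ for $t\in[\tau,T]$, and $y$ solves $(*)$ on $[0,T]$ in the following sense. For every $t<\tau$, $y$ solves $(*)$ on $[0,t]$ with usual Young integrals. Moreover there is $c>0$ such that for all $0\le s<\tau\le t\le T$ one has $y_t-y_s=\sum_{j=1}^d I^j$, where the vectors $I^j=\int_s^t\sigma^j(y_u)\,dx^j_u$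 are limits of Riemann sums: for all sufficiently small $\varepsilon>0$ and every $\delta>0$ there are a partition $s=t_0<\dots<t_n=t$ and an index $j^*$ with $t_{j^*}<\tau\le t_{j^*+1}$ and $\eta\le|\tau-t_{j^*}|\le2\eta$, $\eta=c\,\varepsilon^{1/\gamma}$, all intervals $[t_i,t_{i+1}]$, $i\ne j^*$, being shorter than $\delta$, such that for all $j$ $$\Big|I^j-\sum_{i=0}^{n-1}\sigma^j(y_{t_i})\,(x^j_{t_{i+1}}-x^j_{t_i})\Big|\le\varepsilon .$$ -/

import Mathlib

open Set Filter Topology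
open scoped NNReal

/-- `f` is Hölder continuous of order `r` on the set `S`. -/
def IsHolderOn {X Y : Type*} [PseudoEMetricSpace X] [PseudoEMetricSpace Y]
    (r : ℝ≥0) (f : X → Y) (S : Set X) : Prop :=
  ∃ C : ℝ≥0, HolderOnWith C r f S

/-- Growth condition: `σ 0 = 0` and `|σ ξ₂ - σ ξ₁| ≲ | |ξ₂|^κ - |ξ₁|^κ |` for a `κ ∈ (0,1)`
with `γ (κ + 1) < 1`. -/
structure IsPowerDominated {m : ℕ} (γ : ℝ≥0) (κ : ℝ)
    (σ : EuclideanSpace ℝ (Fin m) → EuclideanSpace ℝ (Fin m)) : Prop where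
  kappa_pos : 0 < κ
  kappa_lt_one : κ < 1
  exponent_lt : (γ : ℝ) * (κ + 1) < 1
  map_zero : σ 0 = 0
  bound : ∃ N : ℝ, ∀ ξ₁ ξ₂ : EuclideanSpace ℝ (Fin m),
    ‖σ ξ₂ - σ ξ₁‖ ≤ N * |‖ξ₂‖ ^ κ - ‖ξ₁‖ ^ κ|

/-- A coefficient behaving like a power: in addition to `IsPowerDominated`,
`|σ ξ| ≳ |ξ|^κ`, and away from the origin `σ` is differentiable with a gradient that is locally
Hölder continuous of some order larger than `1/γ - 1`. -/
structure IsPowerLike {m : ℕ} (γ : ℝ≥0) (κ : ℝ)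
    (σ : EuclideanSpace ℝ (Fin m) → EuclideanSpace ℝ (Fin m)) : Prop
    extends IsPowerDominated γ κ σ where
  lower_bound : ∃ c : ℝ, 0 < c ∧ ∀ ξ : EuclideanSpace ℝ (Fin m), c * ‖ξ‖ ^ κ ≤ ‖σ ξ‖
  differentiable : ∀ ξ : EuclideanSpace ℝ (Fin m), ξ ≠ 0 → DifferentiableAt ℝ σ ξ
  gradient_holder : ∃ β : ℝ≥0, 1 / (γ : ℝ) - 1 < (β : ℝ) ∧
    ∀ ξ : EuclideanSpace ℝ (Fin m), ξ ≠ 0 → ∃ U ∈ 𝓝 ξ, IsHolderOn β (fderiv ℝ σ) U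

/-- `x` is `θ`-Hölder rough on `[0,T]`: at every time, at every scale and in every direction
it has an increment of size comparable to `ε ^ θ` at least. -/
def IsHolderRough {d : ℕ} (T θ : ℝ) (x : ℝ → EuclideanSpace ℝ (Fin d)) : Prop :=
  ∃ c : ℝ, 0 < c ∧ ∀ s ∈ Icc 0 T, ∀ ε ∈ Ioc 0 (T / 2),
    ∀ φ : EuclideanSpace ℝ (Fin d), ‖φ‖ = 1 →
      ∃ t ∈ Icc 0 T, ε / 2 < |t - s| ∧ |t - s| < ε ∧ c * ε ^ θ < |inner ℝ φ (x t - x s)|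

/-- `p 0 < p 1 < ... < p n` is a partition of `[s,t]` (the values `p i`, `i > n`, are
irrelevant). -/
def IsPartition (s t : ℝ) (n : ℕ) (p : ℕ → ℝ) : Prop :=
  p 0 = s ∧ p n = t ∧ ∀ i < n, p i < p (i + 1)

/-- The Riemann sum `∑ f(p i) (x(p (i+1)) - x(p i))` along `p 0 < ... < p n`. -/
noncomputable def riemannSum {m : ℕ} (f : ℝ → EuclideanSpace ℝ (Fin m)) (x : ℝ → ℝ)
    (n : ℕ) (p : ℕ → ℝ) : EuclideanSpace ℝ (Fin m) :=
  ∑ i ∈ Finset.range n, (x (p (i + 1)) - x (p i)) • f (p i)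

/-- `I` is the usual Young integral `∫_s^t f dx`: `f` and `x` are Hölder continuous on `[s,t]` of
orders with sum larger than `1`, and the Riemann sums converge to `I` as the mesh tends to `0`. -/
def HasYoungIntegral {m : ℕ} (f : ℝ → EuclideanSpace ℝ (Fin m)) (x : ℝ → ℝ) (s t : ℝ)
    (I : EuclideanSpace ℝ (Fin m)) : Prop :=
  (∃ α β : ℝ≥0, 0 < α ∧ 0 < β ∧ 1 < α + β ∧
    IsHolderOn α f (Icc s t) ∧ IsHolderOn β x (Icc s t)) ∧
  ∀ ε : ℝ, 0 < ε → ∃ δ : ℝ, 0 < δ ∧ ∀ (n : ℕ) (p : ℕ → ℝ), IsPartition s t n p →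
    (∀ i < n, p (i + 1) - p i < δ) → ‖I - riemannSum f x n p‖ ≤ ε

/-- `y` solves `y_t = a + ∑_j ∫_0^t σ^j(y_u) dx^j_u` for all `t ∈ [0,S]`, with usual Young
integrals. -/
def IsYoungSolution {m d : ℕ}
    (σ : Fin d → EuclideanSpace ℝ (Fin m) → EuclideanSpace ℝ (Fin m))
    (x : ℝ → EuclideanSpace ℝ (Fin d)) (a : EuclideanSpace ℝ (Fin m)) (S : ℝ)
    (y : ℝ → EuclideanSpace ℝ (Fin m)) : Prop :=
  ∀ t ∈ Icc 0 S, ∃ I : Fin d → EuclideanSpace ℝ (Fin m),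
    (∀ j, HasYoungIntegral (fun u => σ j (y u)) (fun u => x u j) 0 t (I j)) ∧
    y t = a + ∑ j, I j

/-- The partitions of `[s,t]` whose `k`-th interval `[p k, p (k+1)]` is the one that contains the
time `τ`, with `p k` at distance between `η` and `2 η` to the left of `τ`. -/
def IsPartitionAround (s t τ η : ℝ) (n : ℕ) (p : ℕ → ℝ) (k : ℕ) : Prop :=
  IsPartition s t n p ∧ k < n ∧ p k < τ ∧ τ ≤ p (k + 1) ∧ η ≤ |τ - p k| ∧ |τ - p k| ≤ 2 * η

/-- The vectors `I j` are the integrals `∫_s^t f^j dx^j`, `s < τ ≤ t`, understood as limits of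
Riemann sums along partitions that approach `τ` from the left at distance of order
`η = c ε^{1/γ}`: for all small `ε` there is such a partition, with all its intervals other than the
one that contains `τ` as short as one likes, along which the Riemann sums are `ε`-close to
`I j`. -/
def HasRiemannSumIntegrals {m d : ℕ} (γ : ℝ≥0) (c τ : ℝ)
    (f : Fin d → ℝ → EuclideanSpace ℝ (Fin m)) (x : ℝ → EuclideanSpace ℝ (Fin d)) (s t : ℝ)
    (I : Fin d → EuclideanSpace ℝ (Fin m)) : Prop :=
  ∃ ε₀ : ℝ, 0 < ε₀ ∧ ∀ ε : ℝ, 0 < ε → ε < ε₀ → ∀ δ : ℝ, 0 < δ →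
    ∃ (n : ℕ) (p : ℕ → ℝ) (k : ℕ),
      IsPartitionAround s t τ (c * ε ^ (1 / (γ : ℝ))) n p k ∧
      (∀ i < n, i ≠ k → p (i + 1) - p i < δ) ∧
      ∀ j, ‖I j - riemannSum (f j) (fun u => x u j) n p‖ ≤ ε

/-- `y` solves the equation on `[0,T]` although it may vanish from the time `τ` on: it is a Young
solution on `[0,t]` for all `t < τ`, and over every `[s,t]` with `s < τ ≤ t` the increment of `y`
is the sum of the integrals of `σ^j(y)` against `x^j`, understood as limits of Riemann sums.
(Increments over intervals to the right of `τ` are zero, as `σ^j` vanishes at `0`.) -/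
def IsRiemannSumSolution {m d : ℕ} (γ : ℝ≥0)
    (σ : Fin d → EuclideanSpace ℝ (Fin m) → EuclideanSpace ℝ (Fin m))
    (x : ℝ → EuclideanSpace ℝ (Fin d)) (a : EuclideanSpace ℝ (Fin m)) (T τ : ℝ)
    (y : ℝ → EuclideanSpace ℝ (Fin m)) : Prop :=
  (∀ t : ℝ, 0 ≤ t → t < τ → IsYoungSolution σ x a t y) ∧
  ∃ c : ℝ, 0 < c ∧ ∀ s t : ℝ, 0 ≤ s → s < τ → τ ≤ t → t ≤ T →
    ∃ I : Fin d → EuclideanSpace ℝ (Fin m),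
      HasRiemannSumIntegrals γ c τ (fun j u => σ j (y u)) x s t I ∧
      y t - y s = ∑ j, I j

/-! The solution is a limit of Euler schemes on uniform grids, and the whole matter is to find
estimates that do not see the mesh although `σ` is not Lipschitz at the origin. Let θ = γ + ε₁ be
the Hölder order of `x`. At a point of norm ρ > 0 the coefficients are at most of order ρ^κ and have
Lipschitz constant of order ρ^(κ-1). Hence, for times h with h^θ ≲ ρ^(1-κ), the scheme keeps its
norm between ρ/2 and 3ρ/2, and a discrete sewing argument (`norm_remainder_le`, `local_estimate`)
yields its first order expansion with error of order h^(2θ), where 2θ > 1.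

Once such a time h is used up, ρ ≲ h^(θ/(1-κ)), so the increment over it, of order ρ^κ h^θ, is at
most of order h^(θ/(1-κ)). As θ + κ > 1, this exponent exceeds 1 and the power is superadditive: any
number of such pieces can be joined without loss (`holder_estimate`). The resulting bound contains
the maximum of the scheme only to the power κ < 1, so it closes to an a priori bound.

Pointwise limits along an ultrafilter inherit the Hölder bound and the expansion
(`exists_limit_of_euler_schemes`). While the limit does not vanish, summing the expansion over a
fine partition identifies the Young integral (`hasYoungIntegral_of_expansion`). If the limit
vanishes somewhere, it is frozen at 0 from its first zero τ on. The one interval from τ - η to τ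
then costs O(η^γ), which is at most ε/2 when η = c ε^(1/γ) with c small
(`hasRiemannSumIntegrals_of_vanishing`). -/

/-- Away from the origin a power with exponent in `(0,1)` is Lipschitz. -/
theorem abs_rpow_sub_rpow_le {κ r u v : ℝ} (hκ : 0 < κ) (hκ1 : κ < 1) (hr : 0 < r)
    (hu : r / 2 ≤ u) (hv : r / 2 ≤ v) :
    |v ^ κ - u ^ κ| ≤ 2 * r ^ (κ - 1) * |v - u| := by
  have key : ∀ u v : ℝ, r / 2 ≤ u → u ≤ v → v ^ κ - u ^ κ ≤ 2 * r ^ (κ - 1) * (v - u) := by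
    intro u v hu huv
    have hu0 : 0 < u := by linarith
    have hv0 : 0 < v := by linarith
    have h1 : v ^ κ = u ^ κ * (v / u) ^ κ := by
      rw [← Real.mul_rpow hu0.le (by positivity)]
      congr 1
      field_simp
    have h2 : (v / u) ^ κ ≤ v / u :=
      Real.rpow_le_self_of_one_le ((one_le_div hu0).2 huv) hκ1.le
    have h3 : u ^ κ = u ^ (κ - 1) * u := by
      rw [Real.rpow_sub_one hu0.ne']
      field_simp
    have h4 : u ^ (κ - 1) ≤ (r / 2) ^ (κ - 1) :=
      Real.rpow_le_rpow_of_nonpos (by positivity) hu (by linarith)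
    have h5 : (r / 2) ^ (κ - 1) ≤ 2 * r ^ (κ - 1) := by
      rw [Real.div_rpow hr.le (by norm_num), div_eq_mul_inv, ← Real.rpow_neg (by norm_num), mul_comm]
      gcongr
      exact Real.rpow_le_self_of_one_le (by norm_num) (by linarith)
    calc v ^ κ - u ^ κ ≤ u ^ κ * (v / u) - u ^ κ := by
          rw [h1]
          gcongr
      _ = u ^ (κ - 1) * (v - u) := by
          rw [h3]
          field_simp
      _ ≤ 2 * r ^ (κ - 1) * (v - u) := by
          gcongr
          · linarith
  rcases le_total u v with h | h
  · rw [abs_of_nonneg (sub_nonneg.2 (Real.rpow_le_rpow (by linarith) h hκ.le)),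
      abs_of_nonneg (sub_nonneg.2 h)]
    exact key u v hu h
  · rw [abs_sub_comm, abs_sub_comm v u,
      abs_of_nonneg (sub_nonneg.2 (Real.rpow_le_rpow (by linarith) h hκ.le)),
      abs_of_nonneg (sub_nonneg.2 h)]
    exact key v u hv h

/-! ### Discrete sewing for Euler schemes -/

section Euler

variable {E : Type*} [NormedAddCommGroup E] [NormedSpace ℝ E] {d : ℕ}

/-- `y` is the Euler scheme started at `a` with coefficients `σ` along the increments of `X`;
`Z · j` collects the contribution of the `j`-th coefficient. -/
structure IsEulerScheme (σ : Fin d → E → E) (X : ℕ → Fin d → ℝ) (a : E)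
    (Z : ℕ → Fin d → E) (y : ℕ → E) : Prop where
  zero : ∀ j, Z 0 j = 0
  succ : ∀ i j, Z (i + 1) j = Z i j + (X (i + 1) j - X i j) • σ j (y i)
  eq_sum : ∀ i, y i = a + ∑ j, Z i j

/-- `X` is Hölder continuous of order `θ`, uniformly, as a function on the grid of mesh `μ`. -/
def IsGridHolder (H θ μ : ℝ) (X : ℕ → Fin d → ℝ) : Prop :=
  ∀ i L j, |X (i + L) j - X i j| ≤ H * (μ * L) ^ θ

theorem IsEulerScheme.norm_sub_le {σ : Fin d → E → E} {X : ℕ → Fin d → ℝ} {a : E}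
    {Z : ℕ → Fin d → E} {y : ℕ → E} (hE : IsEulerScheme σ X a Z y) {i k : ℕ} {C : ℝ}
    (h : ∀ j, ‖Z i j - Z k j‖ ≤ C) : ‖y i - y k‖ ≤ d * C := by
  rw [hE.eq_sum i, hE.eq_sum k, add_sub_add_left_eq_sub, ← Finset.sum_sub_distrib]
  refine (norm_sum_le_of_le _ fun j _ => h j).trans ?_
  simp

/-- Discrete sewing: halving an interval multiplies the sum of the two remainders by 2^(1-2θ) < 1
when θ > 1/2, and `hAc` says that the defect created by the splitting fits into what is gained. Only
positions before `n` need to lie in `U`, so the estimate can itself be used to show that the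
position at `n` does. -/
theorem IsEulerScheme.norm_remainder_le {σ : Fin d → E → E} {X : ℕ → Fin d → ℝ} {a : E}
    {Z : ℕ → Fin d → E} {y : ℕ → E} (hE : IsEulerScheme σ X a Z y)
    {H θ μ Λ S A c : ℝ} (hX : IsGridHolder H θ μ X) (hH : 0 ≤ H) (hθ : 0 < θ) (hμ : 0 < μ)
    (hΛ : 0 ≤ Λ) (hS : 0 ≤ S) (hA : 0 ≤ A)
    (hAc : 2 * (1 / 2) ^ (2 * θ) * A + 2 * H * d * (H + A * c) ≤ A)
    {U : Set E} (hlip : ∀ j, ∀ ξ ∈ U, ∀ ζ ∈ U, ‖σ j ζ - σ j ξ‖ ≤ Λ * ‖ζ - ξ‖)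
    (hbd : ∀ j, ∀ ξ ∈ U, ‖σ j ξ‖ ≤ S) {k n : ℕ} (hU : ∀ i, k ≤ i → i < n → y i ∈ U)
    {h : ℝ} (hn : μ * (n - k : ℕ) ≤ h) (hh : Λ * h ^ θ ≤ c) (L : ℕ) :
    ∀ i, k ≤ i → i + L ≤ n → ∀ j, ‖Z (i + L) j - Z i j - (X (i + L) j - X i j) • σ j (y i)‖ ≤
      A * Λ * S * (μ * L) ^ (2 * θ) := by
  induction L using Nat.strong_induction_on with
  | _ L ih =>
  intro i hki hiL j
  rcases Nat.lt_or_ge L 2 with hL | hL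
  · interval_cases L
    · simp [hθ.ne']
    · rw [hE.succ]
      simp only [add_sub_cancel_left, sub_self, norm_zero]
      positivity
  -- The single step in the middle has zero remainder and absorbs the parity of `L`: both outer
  -- pieces have length at most `L / 2`, so the factor (1/2)^(2θ) is exact.
  obtain ⟨p, q, hpq, hpL, hqL, hq1, hp1⟩ : ∃ p q : ℕ, p + 1 + q = L ∧ 2 * p ≤ L ∧ 2 * q ≤ L ∧
      1 ≤ q ∧ p + 1 < L := ⟨(L - 1) / 2, L - 1 - (L - 1) / 2, by omega, by omega, by omega,
      by omega, by omega⟩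
  have hL0 : (0:ℝ) < μ * L := by
    have : (0:ℝ) < L := by exact_mod_cast (by omega : 0 < L)
    positivity
  have hLh : μ * L ≤ h := by
    refine le_trans ?_ hn
    gcongr
    omega
  have hsq : (μ * L) ^ (2 * θ) = (μ * L) ^ θ * (μ * L) ^ θ := by
    rw [← Real.rpow_add hL0, two_mul]
  -- increments of `y` over shorter intervals
  have hy : ∀ P : ℕ, P < L → ‖y (i + P) - y i‖ ≤ d * ((H + A * c) * S * (μ * L) ^ θ) := by
    intro P hP
    refine hE.norm_sub_le fun j => ?_
    have h1 := ih P hP i hki (by omega) j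
    have h2 : ‖(X (i + P) j - X i j) • σ j (y i)‖ ≤ H * (μ * L) ^ θ * S := by
      rw [norm_smul, Real.norm_eq_abs]
      refine mul_le_mul ((hX i P j).trans ?_) (hbd j _ (hU i hki (by omega))) (norm_nonneg _)
        (by positivity)
      gcongr
    have h3 : A * Λ * S * (μ * P) ^ (2 * θ) ≤ A * S * c * (μ * L) ^ θ := by
      calc A * Λ * S * (μ * P) ^ (2 * θ) ≤ A * Λ * S * (μ * L) ^ (2 * θ) := by gcongr
        _ = A * S * (Λ * (μ * L) ^ θ) * (μ * L) ^ θ := by rw [hsq]; ring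
        _ ≤ A * S * c * (μ * L) ^ θ := by
            gcongr
            exact le_trans (by gcongr) hh
    calc ‖Z (i + P) j - Z i j‖
        = ‖(Z (i + P) j - Z i j - (X (i + P) j - X i j) • σ j (y i)) +
          (X (i + P) j - X i j) • σ j (y i)‖ := by rw [sub_add_cancel]
      _ ≤ A * S * c * (μ * L) ^ θ + H * (μ * L) ^ θ * S :=
          norm_add_le_of_le (h1.trans h3) h2
      _ = (H + A * c) * S * (μ * L) ^ θ := by ring
  have hcross : ∀ P Q : ℕ, P < L → Q ≤ L →
      ‖(X (i + P + Q) j - X (i + P) j) • (σ j (y (i + P)) - σ j (y i))‖ ≤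
        H * d * (H + A * c) * Λ * S * (μ * L) ^ (2 * θ) := by
    intro P Q hP hQ
    rw [norm_smul, Real.norm_eq_abs]
    calc |X (i + P + Q) j - X (i + P) j| * ‖σ j (y (i + P)) - σ j (y i)‖
        ≤ (H * (μ * L) ^ θ) * (Λ * (d * ((H + A * c) * S * (μ * L) ^ θ))) := by
          refine mul_le_mul ((hX (i + P) Q j).trans ?_) ?_ (norm_nonneg _) (by positivity)
          · gcongr
          · refine (hlip j _ (hU i hki (by omega)) _ (hU _ (by omega) (by omega))).trans ?_
            gcongr
            exact hy P hP
      _ = _ := by rw [hsq]; ring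
  have hhalf : ∀ P : ℕ, 2 * P ≤ L → A * Λ * S * (μ * P) ^ (2 * θ) ≤
      (1 / 2) ^ (2 * θ) * A * (Λ * S * (μ * L) ^ (2 * θ)) := by
    intro P hP
    have hP' : μ * P ≤ 1 / 2 * (μ * L) := by
      have : (2 * P : ℝ) ≤ L := by exact_mod_cast hP
      nlinarith
    calc A * Λ * S * (μ * P) ^ (2 * θ) ≤ A * Λ * S * (1 / 2 * (μ * L)) ^ (2 * θ) := by gcongr
      _ = _ := by rw [Real.mul_rpow (by norm_num) hL0.le]; ring
  have e1 := (ih p (by omega) i hki (by omega) j).trans (hhalf p hpL)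
  have e2 := (ih q (by omega) (i + (p + 1)) (by omega) (by omega) j).trans (hhalf q hqL)
  have e3 := hcross p 1 (by omega) (by omega)
  have e4 := hcross (p + 1) q hp1 (by omega)
  have hsucc := hE.succ (i + p) j
  have hidx : i + L = i + (p + 1) + q := by omega
  rw [hidx]
  have hdec : Z (i + (p + 1) + q) j - Z i j - (X (i + (p + 1) + q) j - X i j) • σ j (y i) =
      ((Z (i + p) j - Z i j - (X (i + p) j - X i j) • σ j (y i)) +
      (Z (i + (p + 1) + q) j - Z (i + (p + 1)) j -
        (X (i + (p + 1) + q) j - X (i + (p + 1)) j) • σ j (y (i + (p + 1))))) +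
      ((X (i + p + 1) j - X (i + p) j) • (σ j (y (i + p)) - σ j (y i)) +
      (X (i + (p + 1) + q) j - X (i + (p + 1)) j) • (σ j (y (i + (p + 1))) - σ j (y i))) := by
    rw [← add_assoc i p 1, hsucc]
    module
  rw [hdec]
  refine (norm_add_le_of_le (norm_add_le_of_le e1 e2) (norm_add_le_of_le e3 e4)).trans ?_
  calc _ = (2 * (1 / 2) ^ (2 * θ) * A + 2 * H * d * (H + A * c)) *
        (Λ * S * (μ * L) ^ (2 * θ)) := by ring
    _ ≤ A * (Λ * S * (μ * L) ^ (2 * θ)) := by gcongr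
    _ = _ := by ring

end Euler

/-! ### Mesh-independent estimates in spite of the singularity at the origin -/

section Euler

variable {E : Type*} [NormedAddCommGroup E] [NormedSpace ℝ E] {d : ℕ}

/-- With b = 2^(1-2θ) < 1, the value of `A` makes (1-b)A twice the term 2H²d, and a small `c` keeps
the term with `A * c` within the other half. The last inequality confines the scheme to
displacements of at most half its initial norm. -/
theorem exists_sewing_constants {H θ : ℝ} (hH : 0 ≤ H) (hθ : 1 / 2 < θ) (d : ℕ) :
    ∃ A c : ℝ, 0 ≤ A ∧ 0 < c ∧ 2 * (1 / 2) ^ (2 * θ) * A + 2 * H * d * (H + A * c) ≤ A ∧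
      d * c * (H + A * c) ≤ 1 / 2 := by
  set b : ℝ := 2 * (1 / 2) ^ (2 * θ) with hb
  have hb1 : b < 1 := by
    have : ((1:ℝ) / 2) ^ (2 * θ) < (1 / 2) ^ (1:ℝ) :=
      Real.rpow_lt_rpow_of_exponent_gt (by norm_num) (by norm_num) (by linarith)
    rw [Real.rpow_one] at this
    linarith
  have hq : 0 < 1 - b := by linarith
  have hd : (0:ℝ) ≤ d := Nat.cast_nonneg d
  set A : ℝ := 4 * H ^ 2 * d / (1 - b) with hA
  have hA0 : 0 ≤ A := by positivity
  have hAq : (1 - b) * A = 4 * H ^ 2 * d := by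
    rw [hA]
    field_simp
  -- The sum of the two denominators that `c` has to beat; 1 - b is added to keep it positive when
  -- `H` or `d` is zero.
  set e : ℝ := 4 * H * d + 2 * d * (H + A) + (1 - b) with he
  have he0 : 0 < e := by positivity
  refine ⟨A, min 1 ((1 - b) / e), hA0, by positivity, ?_, ?_⟩
  · set c := min 1 ((1 - b) / e) with hc
    have hc0 : 0 < c := by positivity
    have h1 : c * (4 * H * d) ≤ 1 - b := by
      have h3 : c * e ≤ 1 - b := (le_div_iff₀ he0).1 (min_le_right _ _)
      refine le_trans (mul_le_mul_of_nonneg_left ?_ hc0.le) h3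
      have : 0 ≤ 2 * d * (H + A) := by positivity
      linarith
    have h2 : A * (c * (4 * H * d)) ≤ A * (1 - b) := mul_le_mul_of_nonneg_left h1 hA0
    nlinarith
  · set c := min 1 ((1 - b) / e) with hc
    have hc0 : 0 < c := by positivity
    have hc1 : c ≤ 1 := min_le_left _ _
    have hb0 : 0 ≤ b := by positivity
    have h3 : c * e ≤ 1 - b := (le_div_iff₀ he0).1 (min_le_right _ _)
    have h1 : c * (2 * d * (H + A)) ≤ 1 := by
      refine le_trans (mul_le_mul_of_nonneg_left ?_ hc0.le) (h3.trans (by linarith))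
      have : 0 ≤ 4 * H * d := by positivity
      linarith
    have h4 : d * c * (H + A * c) ≤ d * c * (H + A * 1) := by gcongr
    linarith

variable {σ : Fin d → E → E} {X : ℕ → Fin d → ℝ} {a : E} {Z : ℕ → Fin d → E} {y : ℕ → E}
  {H θ μ N κ A c : ℝ}

omit [NormedSpace ℝ E] in
theorem norm_le_of_power_bound (hσ0 : ∀ j, σ j 0 = 0) (hκ : 0 < κ)
    (hσ : ∀ j ξ ζ, ‖σ j ζ - σ j ξ‖ ≤ N * |‖ζ‖ ^ κ - ‖ξ‖ ^ κ|) (j : Fin d) (ξ : E) :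
    ‖σ j ξ‖ ≤ N * ‖ξ‖ ^ κ := by
  have := hσ j 0 ξ
  rwa [hσ0, sub_zero, norm_zero, Real.zero_rpow hκ.ne', sub_zero,
    abs_of_nonneg (Real.rpow_nonneg (norm_nonneg _) _)] at this

/-- As long as the scheme has not had the time to move far away from a nonzero position, it is
described by its first order expansion. -/
theorem IsEulerScheme.local_estimate (hE : IsEulerScheme σ X a Z y) (hX : IsGridHolder H θ μ X)
    (hH : 0 ≤ H) (hθ : 0 < θ) (hμ : 0 < μ) (hκ : 0 < κ) (hκ1 : κ < 1) (hN : 0 < N)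
    (hA : 0 ≤ A) (hc : 0 < c)
    (hAc : 2 * (1 / 2) ^ (2 * θ) * A + 2 * H * d * (H + A * c) ≤ A)
    (hdc : d * c * (H + A * c) ≤ 1 / 2)
    (hσ0 : ∀ j, σ j 0 = 0) (hσ : ∀ j ξ ζ, ‖σ j ζ - σ j ξ‖ ≤ N * |‖ζ‖ ^ κ - ‖ξ‖ ^ κ|)
    {k L : ℕ} (hk : y k ≠ 0) (hL : 2 * N * (μ * L) ^ θ ≤ c * ‖y k‖ ^ (1 - κ)) :
    (∀ j, ‖Z (k + L) j - Z k j - (X (k + L) j - X k j) • σ j (y k)‖ ≤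
      A * (2 * N * ‖y k‖ ^ (κ - 1)) * (2 * N * ‖y k‖ ^ κ) * (μ * L) ^ (2 * θ)) ∧
    ∀ j, ‖Z (k + L) j - Z k j‖ ≤ (H + A * c) * (2 * N) * ‖y k‖ ^ κ * (μ * L) ^ θ := by
  set ρ := ‖y k‖ with hρ
  have hρ0 : 0 < ρ := norm_pos_iff.2 hk
  set U : Set E := {ξ | ρ / 2 ≤ ‖ξ‖ ∧ ‖ξ‖ ≤ 3 / 2 * ρ} with hU
  have hΛc : 2 * N * ρ ^ (κ - 1) * (μ * L) ^ θ ≤ c := by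
    have h1 : ρ ^ (κ - 1) * ρ ^ (1 - κ) = 1 := by
      rw [← Real.rpow_add hρ0]
      simp
    calc 2 * N * ρ ^ (κ - 1) * (μ * L) ^ θ = ρ ^ (κ - 1) * (2 * N * (μ * L) ^ θ) := by ring
      _ ≤ ρ ^ (κ - 1) * (c * ρ ^ (1 - κ)) := by gcongr
      _ = c * (ρ ^ (κ - 1) * ρ ^ (1 - κ)) := by ring
      _ = c := by rw [h1, mul_one]
  have hbd : ∀ j, ∀ ξ ∈ U, ‖σ j ξ‖ ≤ 2 * N * ρ ^ κ := by
    intro j ξ hξ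
    have h1 : (3 / 2 : ℝ) ^ κ ≤ 2 :=
      (Real.rpow_le_self_of_one_le (by norm_num) hκ1.le).trans (by norm_num)
    calc ‖σ j ξ‖ ≤ N * ‖ξ‖ ^ κ := norm_le_of_power_bound hσ0 hκ hσ j ξ
      _ ≤ N * (3 / 2 * ρ) ^ κ := by
          gcongr
          exact hξ.2
      _ = N * ((3 / 2) ^ κ * ρ ^ κ) := by rw [Real.mul_rpow (by norm_num) hρ0.le]
      _ ≤ N * (2 * ρ ^ κ) := by gcongr
      _ = 2 * N * ρ ^ κ := by ring
  have hlip : ∀ j, ∀ ξ ∈ U, ∀ ζ ∈ U, ‖σ j ζ - σ j ξ‖ ≤ 2 * N * ρ ^ (κ - 1) * ‖ζ - ξ‖ := by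
    intro j ξ hξ ζ hζ
    calc ‖σ j ζ - σ j ξ‖ ≤ N * |‖ζ‖ ^ κ - ‖ξ‖ ^ κ| := hσ j ξ ζ
      _ ≤ N * (2 * ρ ^ (κ - 1) * |‖ζ‖ - ‖ξ‖|) := by
          gcongr
          exact abs_rpow_sub_rpow_le hκ hκ1 hρ0 hξ.1 hζ.1
      _ ≤ N * (2 * ρ ^ (κ - 1) * ‖ζ - ξ‖) := by
          gcongr
          exact abs_norm_sub_norm_le ζ ξ
      _ = 2 * N * ρ ^ (κ - 1) * ‖ζ - ξ‖ := by ring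
  have hmono : ∀ P ≤ L, (μ * (P:ℝ)) ^ θ ≤ (μ * L) ^ θ := by
    intro P hP
    gcongr
  -- Bootstrap: positions strictly before `k + P` in the annulus suffice to bound the increment up
  -- to `k + P`, and by `hdc` that increment is at most ρ/2. So the scheme cannot leave the annulus.
  have step : ∀ P ≤ L, (∀ i, k ≤ i → i < k + P → y i ∈ U) →
      (∀ j, ‖Z (k + P) j - Z k j - (X (k + P) j - X k j) • σ j (y k)‖ ≤
        A * (2 * N * ρ ^ (κ - 1)) * (2 * N * ρ ^ κ) * (μ * P) ^ (2 * θ)) ∧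
      ∀ j, ‖Z (k + P) j - Z k j‖ ≤ (H + A * c) * (2 * N) * ρ ^ κ * (μ * P) ^ θ := by
    intro P hP hPU
    have h1 : ∀ j, ‖Z (k + P) j - Z k j - (X (k + P) j - X k j) • σ j (y k)‖ ≤
        A * (2 * N * ρ ^ (κ - 1)) * (2 * N * ρ ^ κ) * (μ * P) ^ (2 * θ) := fun j =>
      hE.norm_remainder_le hX hH hθ hμ (by positivity) (by positivity) hA hAc hlip hbd hPU
        (h := μ * L) (by rw [Nat.add_sub_cancel_left]; gcongr) hΛc P k le_rfl le_rfl j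
    refine ⟨h1, fun j => ?_⟩
    have h2 : (μ * (P:ℝ)) ^ (2 * θ) = (μ * P) ^ θ * (μ * P) ^ θ := by
      rw [two_mul, Real.rpow_add_of_nonneg (by positivity) hθ.le hθ.le]
    have h3 : A * (2 * N * ρ ^ (κ - 1)) * (2 * N * ρ ^ κ) * (μ * P) ^ (2 * θ) ≤
        A * c * (2 * N * ρ ^ κ) * (μ * P) ^ θ := by
      calc _ = A * (2 * N * ρ ^ (κ - 1) * (μ * P) ^ θ) * (2 * N * ρ ^ κ) * (μ * P) ^ θ := by
            rw [h2]; ring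
        _ ≤ _ := by
            gcongr
            exact le_trans (by gcongr) hΛc
    have h4 : ‖(X (k + P) j - X k j) • σ j (y k)‖ ≤ H * (μ * P) ^ θ * (2 * N * ρ ^ κ) := by
      rw [norm_smul, Real.norm_eq_abs]
      exact mul_le_mul (hX k P j) (hbd j _ ⟨by linarith, by linarith⟩) (norm_nonneg _)
        (by positivity)
    calc ‖Z (k + P) j - Z k j‖
        = ‖(Z (k + P) j - Z k j - (X (k + P) j - X k j) • σ j (y k)) +
          (X (k + P) j - X k j) • σ j (y k)‖ := by rw [sub_add_cancel]
      _ ≤ A * c * (2 * N * ρ ^ κ) * (μ * P) ^ θ + H * (μ * P) ^ θ * (2 * N * ρ ^ κ) :=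
          norm_add_le_of_le ((h1 j).trans h3) h4
      _ = _ := by ring
  have hmem : ∀ P ≤ L, y (k + P) ∈ U := by
    intro P
    induction P using Nat.strong_induction_on with
    | _ P ih =>
    intro hP
    have h1 := (step P hP fun i hi hiP => by
      obtain ⟨q, rfl⟩ := Nat.exists_eq_add_of_le hi
      exact ih q (by omega) (by omega)).2
    have h2 := hE.norm_sub_le h1
    have h3 : d * ((H + A * c) * (2 * N) * ρ ^ κ * (μ * P) ^ θ) ≤ ρ / 2 := by
      have h5 : ρ ^ (1 - κ) * ρ ^ κ = ρ := by
        rw [← Real.rpow_add hρ0]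
        simp
      calc d * ((H + A * c) * (2 * N) * ρ ^ κ * (μ * P) ^ θ)
          ≤ d * ((H + A * c) * (2 * N) * ρ ^ κ * (μ * L) ^ θ) := by gcongr
        _ = d * (H + A * c) * ρ ^ κ * (2 * N * (μ * L) ^ θ) := by ring
        _ ≤ d * (H + A * c) * ρ ^ κ * (c * ρ ^ (1 - κ)) := by gcongr
        _ = d * c * (H + A * c) * (ρ ^ (1 - κ) * ρ ^ κ) := by ring
        _ ≤ 1 / 2 * ρ := by
            rw [h5]
            gcongr
        _ = ρ / 2 := by ring
    have h4 := abs_le.1 ((abs_norm_sub_norm_le (y (k + P)) (y k)).trans (h2.trans h3))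
    exact ⟨by linarith [h4.1], by linarith [h4.2]⟩
  refine step L le_rfl fun i hi hiL => ?_
  obtain ⟨q, rfl⟩ := Nat.exists_eq_add_of_le hi
  exact hmem q (by omega)

/-- A uniform Hölder estimate for the Euler scheme, in spite of the singularity of the
coefficients at the origin. -/
theorem IsEulerScheme.holder_estimate (hE : IsEulerScheme σ X a Z y) (hX : IsGridHolder H θ μ X)
    (hH : 0 ≤ H) (hθ : 0 < θ) (hμ : 0 < μ) (hκ : 0 < κ) (hκ1 : κ < 1) (hθκ : 1 < θ + κ)
    (hN : 0 < N) (hA : 0 ≤ A) (hc : 0 < c)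
    (hAc : 2 * (1 / 2) ^ (2 * θ) * A + 2 * H * d * (H + A * c) ≤ A)
    (hdc : d * c * (H + A * c) ≤ 1 / 2)
    (hσ0 : ∀ j, σ j 0 = 0) (hσ : ∀ j ξ ζ, ‖σ j ζ - σ j ξ‖ ≤ N * |‖ζ‖ ^ κ - ‖ξ‖ ^ κ|)
    {n : ℕ} {M : ℝ} (hM : ∀ i ≤ n, ‖y i‖ ≤ M) (L : ℕ) : ∀ k, k + L ≤ n → ∀ j,
    ‖Z (k + L) j - Z k j‖ ≤
      (H + A * c) * (2 * N) * (2 * N / c) ^ (κ / (1 - κ)) * 2 ^ (θ / (1 - κ)) *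
        (μ * L) ^ (θ / (1 - κ)) +
      (H + A * c) * (2 * N) * M ^ κ * (μ * L) ^ θ := by
  set B := (H + A * c) * (2 * N) with hB
  have hB0 : 0 ≤ B := by positivity
  set D := B * (2 * N / c) ^ (κ / (1 - κ)) * 2 ^ (θ / (1 - κ)) with hD
  have hκ' : 0 < 1 - κ := by linarith
  have hD0 : 0 ≤ D := by positivity
  induction L using Nat.strong_induction_on with
  | _ L ih =>
  intro k hkL j
  have hM0 : 0 ≤ M := (norm_nonneg _).trans (hM k (by omega))
  have hρM : ‖y k‖ ^ κ ≤ M ^ κ := by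
    gcongr
    exact hM k (by omega)
  by_cases hcase : y k ≠ 0 ∧ 2 * N * (μ * L) ^ θ ≤ c * ‖y k‖ ^ (1 - κ)
  · have h1 := (hE.local_estimate hX hH hθ hμ hκ hκ1 hN hA hc hAc hdc hσ0 hσ hcase.1 hcase.2).2 j
    refine h1.trans (le_add_of_nonneg_of_le (by positivity) ?_)
    gcongr
  rcases Nat.eq_zero_or_pos L with rfl | hL
  · simp only [Nat.add_zero, sub_self, norm_zero]
    positivity
  set ρ := ‖y k‖ with hρ
  -- the scheme stays close to `y k` for `P` steps, but not for much longer
  obtain ⟨P, hP1, hPL, hP2, hP3⟩ : ∃ P : ℕ, 1 ≤ P ∧ P ≤ L ∧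
      c * ρ ^ (1 - κ) ≤ 2 * N * (2 * (μ * P)) ^ θ ∧
      ‖Z (k + P) j - Z k j‖ ≤ B * ρ ^ κ * (μ * P) ^ θ := by
    have hone : ‖Z (k + 1) j - Z k j‖ ≤ B * ρ ^ κ * (μ * (1:ℕ)) ^ θ := by
      rw [hE.succ, add_sub_cancel_left, norm_smul, Real.norm_eq_abs]
      calc _ ≤ H * (μ * (1:ℕ)) ^ θ * (N * ρ ^ κ) :=
            mul_le_mul (hX k 1 j) (norm_le_of_power_bound hσ0 hκ hσ j _) (norm_nonneg _)
              (by positivity)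
        _ = (H * N) * ρ ^ κ * (μ * (1:ℕ)) ^ θ := by ring
        _ ≤ _ := by
            gcongr
            rw [hB]
            have : 0 ≤ A * c * (2 * N) := by positivity
            nlinarith [mul_nonneg hH hN.le]
    rcases eq_or_ne (y k) 0 with h0 | h0
    · refine ⟨1, le_rfl, hL, ?_, hone⟩
      rw [hρ, h0, norm_zero, Real.zero_rpow hκ'.ne', mul_zero]
      positivity
    have hcase' : c * ρ ^ (1 - κ) < 2 * N * (μ * L) ^ θ := by
      by_contra hcon
      exact hcase ⟨h0, not_lt.1 hcon⟩
    -- `q + 1` is the first number of steps that exceeds the time scale of `y k`. The local estimate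
    -- holds for `q` steps, and q + 1 ≤ 2q explains the factor 2 in the bound; for q = 0 a single
    -- explicit step takes its place.
    obtain ⟨q, hq, hqmin⟩ : ∃ q : ℕ, c * ρ ^ (1 - κ) < 2 * N * (μ * (q + 1 : ℕ)) ^ θ ∧
        ∀ r < q, ¬ c * ρ ^ (1 - κ) < 2 * N * (μ * (r + 1 : ℕ)) ^ θ := by
      classical
      have hex : ∃ q : ℕ, c * ρ ^ (1 - κ) < 2 * N * (μ * (q + 1 : ℕ)) ^ θ :=
        ⟨L - 1, by rwa [Nat.sub_add_cancel hL]⟩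
      exact ⟨Nat.find hex, Nat.find_spec hex, fun r hr => Nat.find_min hex hr⟩
    have hqL : q ≤ L - 1 := by
      by_contra hcon
      exact hqmin (L - 1) (by omega) (by rwa [Nat.sub_add_cancel hL])
    rcases Nat.eq_zero_or_pos q with rfl | hq0
    · refine ⟨1, le_rfl, hL, hq.le.trans (mul_le_mul_of_nonneg_left
        (Real.rpow_le_rpow (by positivity) ?_ hθ.le) (by positivity)), hone⟩
      push_cast
      linarith
    · refine ⟨q, hq0, by omega, hq.le.trans (mul_le_mul_of_nonneg_left
        (Real.rpow_le_rpow (by positivity) ?_ hθ.le) (by positivity)), ?_⟩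
      · have h1 : (1:ℝ) ≤ q := by exact_mod_cast hq0
        have h2 := mul_le_mul_of_nonneg_left h1 hμ.le
        push_cast
        linarith
      · have h2 := hqmin (q - 1) (Nat.sub_lt hq0 one_pos)
        rw [Nat.sub_add_cancel (show 1 ≤ q from hq0), not_lt] at h2
        exact (hE.local_estimate hX hH hθ hμ hκ hκ1 hN hA hc hAc hdc hσ0 hσ h0 h2).2 j
  have hP0 : (0:ℝ) < μ * P := by
    have : (0:ℝ) < P := by exact_mod_cast hP1
    positivity
  have hρκ : ρ ^ κ ≤ (2 * N / c) ^ (κ / (1 - κ)) * (2 * (μ * P)) ^ (θ * (κ / (1 - κ))) := by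
    have h1 : ρ ^ (1 - κ) ≤ 2 * N / c * (2 * (μ * P)) ^ θ := by
      rw [div_mul_eq_mul_div, le_div_iff₀ hc]
      linarith
    calc ρ ^ κ = (ρ ^ (1 - κ)) ^ (κ / (1 - κ)) := by
          rw [← Real.rpow_mul (norm_nonneg _)]
          congr 1
          field_simp
      _ ≤ (2 * N / c * (2 * (μ * P)) ^ θ) ^ (κ / (1 - κ)) := by
          gcongr
      _ = _ := by
          rw [Real.mul_rpow (by positivity) (by positivity), ← Real.rpow_mul (by positivity)]
  have hfirst : ‖Z (k + P) j - Z k j‖ ≤ D * (μ * P) ^ (θ / (1 - κ)) := by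
    calc ‖Z (k + P) j - Z k j‖ ≤ B * ρ ^ κ * (2 * (μ * P)) ^ θ := by
          refine hP3.trans (mul_le_mul_of_nonneg_left
            (Real.rpow_le_rpow hP0.le (by linarith) hθ.le) (by positivity))
      _ ≤ B * ((2 * N / c) ^ (κ / (1 - κ)) * (2 * (μ * P)) ^ (θ * (κ / (1 - κ)))) *
          (2 * (μ * P)) ^ θ := by gcongr
      _ = B * (2 * N / c) ^ (κ / (1 - κ)) * (2 * (μ * P)) ^ (θ * (κ / (1 - κ)) + θ) := by
          rw [Real.rpow_add (by positivity)]
          ring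
      _ = D * (μ * P) ^ (θ / (1 - κ)) := by
          have : θ * (κ / (1 - κ)) + θ = θ / (1 - κ) := by
            field_simp
            ring
          rw [this, Real.mul_rpow (by norm_num) hP0.le, hD]
          ring
  have hrest := ih (L - P) (by omega) (k + P) (by omega) j
  have hidx : k + P + (L - P) = k + L := by omega
  rw [hidx] at hrest
  -- This is where θ + κ > 1 enters. Only the term of order θ/(1-κ) is summed over the pieces; the
  -- term of order θ is produced once, by the last piece.
  have hsuper : (μ * (P:ℝ)) ^ (θ / (1 - κ)) + (μ * ((L - P : ℕ) : ℝ)) ^ (θ / (1 - κ)) ≤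
      (μ * L) ^ (θ / (1 - κ)) := by
    have h1 : 1 ≤ θ / (1 - κ) := by
      rw [le_div_iff₀ hκ']
      linarith
    refine (Real.add_rpow_le_rpow_add hP0.le (by positivity) h1).trans (le_of_eq ?_)
    rw [← mul_add, Nat.cast_sub hPL, add_sub_cancel]
  have hlast : B * M ^ κ * (μ * ((L - P : ℕ) : ℝ)) ^ θ ≤ B * M ^ κ * (μ * L) ^ θ := by
    gcongr
    omega
  calc ‖Z (k + L) j - Z k j‖ = ‖(Z (k + P) j - Z k j) + (Z (k + L) j - Z (k + P) j)‖ := by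
        congr 1
        abel
    _ ≤ _ := norm_add_le_of_le hfirst hrest
    _ = D * ((μ * (P:ℝ)) ^ (θ / (1 - κ)) + (μ * ((L - P : ℕ) : ℝ)) ^ (θ / (1 - κ))) +
        B * M ^ κ * (μ * ((L - P : ℕ) : ℝ)) ^ θ := by ring
    _ ≤ _ := add_le_add (mul_le_mul_of_nonneg_left hsuper hD0) hlast

/-- `M ≤ α + β M ^ κ` with `κ < 1` bounds `M`. -/
theorem le_max_of_le_add_mul_rpow {α β M : ℝ} (hα : 0 ≤ α) (hβ : 0 ≤ β) (hκ1 : κ < 1)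
    (h : M ≤ α + β * M ^ κ) : M ≤ max (2 * α) ((2 * β) ^ (1 / (1 - κ))) := by
  by_contra hcon
  rw [not_le, max_lt_iff] at hcon
  have hκ' : 0 < 1 - κ := by linarith
  have hM0 : 0 < M := by linarith
  -- If `M` exceeded both bounds, α would be less than M/2 and β M^κ at most M/2.
  have h1 : 2 * β ≤ M ^ (1 - κ) := by
    calc 2 * β = ((2 * β) ^ (1 / (1 - κ))) ^ (1 - κ) := by
          rw [← Real.rpow_mul (by positivity), one_div_mul_cancel hκ'.ne', Real.rpow_one]
      _ ≤ _ := by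
          gcongr
          exact hcon.2.le
  have h2 : M ^ (1 - κ) * M ^ κ = M := by
    rw [← Real.rpow_add hM0]
    simp
  have h3 : 2 * β * M ^ κ ≤ M := by
    calc 2 * β * M ^ κ ≤ M ^ (1 - κ) * M ^ κ := by gcongr
      _ = M := h2
  linarith [hcon.1]

end Euler

/-! ### Uniform estimates and passage to the limit -/

section Limit

variable {E : Type*} [NormedAddCommGroup E] [NormedSpace ℝ E] {d : ℕ} {σ : Fin d → E → E}
  {κ θ N H T : ℝ} {a : E}

/-- Estimates for the Euler scheme that do not depend on the mesh. -/
theorem exists_uniform_estimates (hH : 0 ≤ H) (hθ : 1 / 2 < θ) (hκ : 0 < κ)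
    (hκ1 : κ < 1) (hθκ : 1 < θ + κ) (hN : 0 < N) (hT : 0 < T) (hσ0 : ∀ j, σ j 0 = 0)
    (hσ : ∀ j ξ ζ, ‖σ j ζ - σ j ξ‖ ≤ N * |‖ζ‖ ^ κ - ‖ξ‖ ^ κ|) (a : E) :
    ∃ C B c : ℝ, 0 ≤ C ∧ 0 ≤ B ∧ 0 < c ∧ ∀ (μ : ℝ) (n : ℕ) (X : ℕ → Fin d → ℝ)
      (Z : ℕ → Fin d → E) (y : ℕ → E), 0 < μ → μ * n ≤ T → IsGridHolder H θ μ X →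
      IsEulerScheme σ X a Z y →
      (∀ k L : ℕ, k + L ≤ n → ∀ j, ‖Z (k + L) j - Z k j‖ ≤ C * (μ * L) ^ θ) ∧
      ∀ k L : ℕ, y k ≠ 0 → (μ * L) ^ θ ≤ c * ‖y k‖ ^ (1 - κ) → ∀ j,
        ‖Z (k + L) j - Z k j - (X (k + L) j - X k j) • σ j (y k)‖ ≤
          B * ‖y k‖ ^ (κ - 1) * ‖y k‖ ^ κ * (μ * L) ^ (2 * θ) := by
  obtain ⟨A, c, hA, hc, hAc, hdc⟩ := exists_sewing_constants hH hθ d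
  have hθ0 : 0 < θ := by linarith
  have hκ' : 0 < 1 - κ := by linarith
  set B := (H + A * c) * (2 * N) with hB
  have hB0 : 0 ≤ B := by positivity
  set D := B * (2 * N / c) ^ (κ / (1 - κ)) * 2 ^ (θ / (1 - κ)) with hD
  have hD0 : 0 ≤ D := by positivity
  set α := ‖a‖ + d * (D * T ^ (θ / (1 - κ))) with hα
  set β := d * (B * T ^ θ) with hβ
  have hα0 : 0 ≤ α := by positivity
  have hβ0 : 0 ≤ β := by positivity
  set M := max (2 * α) ((2 * β) ^ (1 / (1 - κ))) with hM
  have hM0 : 0 ≤ M := le_max_of_le_left (by positivity)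
  refine ⟨D * T ^ (θ / (1 - κ) - θ) + B * M ^ κ, 4 * A * N ^ 2, c / (2 * N), by positivity,
    by positivity, by positivity, fun μ n X Z y hμ hn hX hE => ⟨fun k L hkL j => ?_,
    fun k L hk hL j => ?_⟩⟩
  · have hμT : ∀ P : ℕ, P ≤ n → μ * P ≤ T := fun P hP => le_trans (by gcongr) hn
    have hyM : ∀ i ≤ n, ‖y i‖ ≤ M := by
      -- The Hölder bound between time 0 and a maximum point of the norm is an inequality for the
      -- maximum itself, sublinear on the right; hence no smallness of `T` is required.
      obtain ⟨i₀, hi₀, hmax⟩ := Finset.exists_max_image (Finset.range (n + 1)) (fun i => ‖y i‖)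
        ⟨0, by simp⟩
      have hi₀n : i₀ ≤ n := by simpa [Nat.lt_succ_iff] using hi₀
      have hmax' : ∀ i ≤ n, ‖y i‖ ≤ ‖y i₀‖ := fun i hi => hmax i (by simpa [Nat.lt_succ_iff])
      have h1 := hE.norm_sub_le (i := 0 + i₀) (k := 0) fun j =>
        hE.holder_estimate hX hH hθ0 hμ hκ hκ1 hθκ hN hA hc hAc hdc hσ0 hσ hmax' i₀ 0 (by omega) j
      have hy0 : y 0 = a := by
        rw [hE.eq_sum]
        simp [hE.zero]
      rw [Nat.zero_add, hy0, ← hB, ← hD] at h1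
      have h2 : ‖y i₀‖ ≤ α + β * ‖y i₀‖ ^ κ := by
        calc ‖y i₀‖ = ‖a + (y i₀ - a)‖ := by rw [add_sub_cancel]
          _ ≤ ‖a‖ + d * (D * (μ * i₀) ^ (θ / (1 - κ)) + B * ‖y i₀‖ ^ κ * (μ * i₀) ^ θ) :=
            norm_add_le_of_le le_rfl h1
          _ ≤ ‖a‖ + d * (D * T ^ (θ / (1 - κ)) + B * ‖y i₀‖ ^ κ * T ^ θ) := by
            gcongr <;> exact hμT i₀ hi₀n
          _ = α + β * ‖y i₀‖ ^ κ := by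
            rw [hα, hβ]
            ring
      exact fun i hi => (hmax' i hi).trans (le_max_of_le_add_mul_rpow hα0 hβ0 hκ1 h2)
    have h1 := hE.holder_estimate hX hH hθ0 hμ hκ hκ1 hθκ hN hA hc hAc hdc hσ0 hσ hyM L k hkL j
    rw [← hB, ← hD] at h1
    have h2 : (μ * (L:ℝ)) ^ (θ / (1 - κ)) ≤ T ^ (θ / (1 - κ) - θ) * (μ * L) ^ θ := by
      have h3 : 0 ≤ θ / (1 - κ) - θ := by
        rw [sub_nonneg, le_div_iff₀ hκ']
        nlinarith
      calc (μ * (L:ℝ)) ^ (θ / (1 - κ)) = (μ * L) ^ (θ / (1 - κ) - θ) * (μ * L) ^ θ := by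
            rw [← Real.rpow_add_of_nonneg (by positivity) h3 hθ0.le, sub_add_cancel]
        _ ≤ _ := by
            gcongr
            exact hμT L (by omega)
    calc ‖Z (k + L) j - Z k j‖ ≤ _ := h1
      _ ≤ D * (T ^ (θ / (1 - κ) - θ) * (μ * L) ^ θ) + B * M ^ κ * (μ * L) ^ θ := by gcongr
      _ = _ := by ring
  · have h1 : 2 * N * (μ * L) ^ θ ≤ c * ‖y k‖ ^ (1 - κ) := by
      calc 2 * N * (μ * L) ^ θ ≤ 2 * N * (c / (2 * N) * ‖y k‖ ^ (1 - κ)) := by gcongr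
        _ = c * ‖y k‖ ^ (1 - κ) := by field_simp
    refine ((hE.local_estimate hX hH hθ0 hμ hκ hκ1 hN hA hc hAc hdc hσ0 hσ hk h1).1 j).trans
      (le_of_eq (by ring))

/-- The cumulative contributions of the coefficients to the Euler scheme. -/
def eulerContributions (σ : Fin d → E → E) (X : ℕ → Fin d → ℝ) (a : E) : ℕ → Fin d → E
  | 0 => 0
  | i + 1 => fun j => eulerContributions σ X a i j +
      (X (i + 1) j - X i j) • σ j (a + ∑ l, eulerContributions σ X a i l)

theorem isEulerScheme_eulerContributions (σ : Fin d → E → E) (X : ℕ → Fin d → ℝ) (a : E) :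
    IsEulerScheme σ X a (eulerContributions σ X a)
      (fun i => a + ∑ j, eulerContributions σ X a i j) :=
  ⟨fun _ => rfl, fun _ _ => rfl, fun _ => rfl⟩

/-- A limit of Euler schemes: a Hölder continuous path with, as long as it does not vanish, the
first order expansion of a solution. -/
theorem exists_limit_of_euler_schemes [ProperSpace E] (hH : 0 ≤ H) (hθ : 1 / 2 < θ) (hκ : 0 < κ)
    (hκ1 : κ < 1) (hθκ : 1 < θ + κ) (hN : 0 < N) (hT : 0 < T) (hσ0 : ∀ j, σ j 0 = 0)
    (hσ : ∀ j ξ ζ, ‖σ j ζ - σ j ξ‖ ≤ N * |‖ζ‖ ^ κ - ‖ξ‖ ^ κ|) (a : E) (x : ℝ → Fin d → ℝ)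
    (hx : ∀ s ∈ Icc 0 T, ∀ t ∈ Icc 0 T, ∀ j, |x t j - x s j| ≤ H * |t - s| ^ θ) :
    ∃ (Z : ℝ → Fin d → E) (y : ℝ → E) (C B c : ℝ), 0 ≤ C ∧ 0 ≤ B ∧ 0 < c ∧
      (∀ j, Z 0 j = 0) ∧ (∀ t, y t = a + ∑ j, Z t j) ∧
      (∀ s t, 0 ≤ s → s ≤ t → t ≤ T → ∀ j, ‖Z t j - Z s j‖ ≤ C * (t - s) ^ θ) ∧
      ∀ s t, 0 ≤ s → s ≤ t → t ≤ T → y s ≠ 0 → (t - s) ^ θ < c * ‖y s‖ ^ (1 - κ) → ∀ j,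
        ‖Z t j - Z s j - (x t j - x s j) • σ j (y s)‖ ≤
          B * ‖y s‖ ^ (κ - 1) * ‖y s‖ ^ κ * (t - s) ^ (2 * θ) := by
  obtain ⟨C, B, c, hC, hB, hc, hest⟩ := exists_uniform_estimates hH hθ hκ hκ1 hθκ hN hT hσ0 hσ a
  have hθ0 : 0 < θ := by linarith
  set μ : ℕ → ℝ := fun n => T / (n + 1) with hμ
  have hμ0 : ∀ n, 0 < μ n := fun n => by positivity
  have hμlim : Tendsto μ atTop (𝓝 0) := by
    simpa [hμ, div_eq_mul_inv] using (tendsto_one_div_add_atTop_nhds_zero_nat (𝕜 := ℝ)).const_mul T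
  -- Freezing the time at `T` makes the grid Hölder bound hold for all indices.
  set X : ℕ → ℕ → Fin d → ℝ := fun n i => x (min (μ n * i) T) with hX
  have hXH : ∀ n, IsGridHolder H θ (μ n) (X n) := by
    intro n i L j
    have hp : ∀ i : ℕ, min (μ n * i) T ∈ Icc 0 T := fun i =>
      ⟨le_min (by have := hμ0 n; positivity) hT.le, min_le_right _ _⟩
    refine (hx _ (hp i) _ (hp (i + L)) j).trans ?_
    gcongr
    have h1 : μ n * (i + L : ℕ) - μ n * i = μ n * L := by
      push_cast
      ring
    have h2 : 0 ≤ μ n * L := by have := hμ0 n; positivity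
    refine (abs_min_sub_min_le_max _ _ _ _).trans ?_
    rw [sub_self, abs_zero, h1, abs_of_nonneg h2, max_eq_left h2]
  set W : ℕ → ℕ → Fin d → E := fun n => eulerContributions σ (X n) a with hW
  set w : ℕ → ℕ → E := fun n i => a + ∑ j, W n i j with hw
  have hE : ∀ n, IsEulerScheme σ (X n) a (W n) (w n) := fun n =>
    isEulerScheme_eulerContributions _ _ _
  set idx : ℕ → ℝ → ℕ := fun n t => ⌊t / μ n⌋₊ with hidx
  have hidx_le : ∀ n t, 0 ≤ t → μ n * idx n t ≤ t := fun n t ht => by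
    have := (le_div_iff₀ (hμ0 n)).1 (Nat.floor_le (div_nonneg ht (hμ0 n).le))
    rwa [mul_comm]
  have hidx_lt : ∀ n t, t - μ n ≤ μ n * idx n t := fun n t => by
    have := (div_lt_iff₀ (hμ0 n)).1 (Nat.lt_floor_add_one (t / μ n))
    simp only [hidx]
    linarith
  have hμn : ∀ n, μ n * (n + 1 : ℕ) = T := fun n => by
    simp only [hμ]
    push_cast
    field_simp
  have hidx_n : ∀ n t, 0 ≤ t → t ≤ T → idx n t ≤ n + 1 := fun n t ht htT => by
    have h1 := (hidx_le n t ht).trans (htT.trans (hμn n).ge)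
    exact_mod_cast le_of_mul_le_mul_left h1 (hμ0 n)
  have hidx_lim : ∀ t, 0 ≤ t → Tendsto (fun n => μ n * idx n t) atTop (𝓝 t) := fun t ht =>
    tendsto_of_tendsto_of_tendsto_of_le_of_le (by simpa using hμlim.const_sub t)
      tendsto_const_nhds (fun n => hidx_lt n t) (fun n => hidx_le n t ht)
  have hidx_mono : ∀ n s t, s ≤ t → idx n s ≤ idx n t := fun n s t hst =>
    Nat.floor_mono (div_le_div_of_nonneg_right hst (hμ0 n).le)
  have hZH : ∀ n s t, 0 ≤ s → s ≤ t → t ≤ T → ∀ j,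
      ‖W n (idx n t) j - W n (idx n s) j‖ ≤ C * (μ n * idx n t - μ n * idx n s) ^ θ := by
    intro n s t hs hst htT j
    obtain ⟨L, hL⟩ := Nat.exists_eq_add_of_le (hidx_mono n s t hst)
    have h1 := (hest (μ n) (n + 1) (X n) (W n) (w n) (hμ0 n) (hμn n).le (hXH n) (hE n)).1
      (idx n s) L (hL ▸ hidx_n n t (hs.trans hst) htT) j
    have h2 : μ n * idx n t - μ n * idx n s = μ n * L := by
      rw [hL]
      push_cast
      ring
    rwa [h2, hL]
  -- pointwise limits along an ultrafilter
  set 𝒰 : Ultrafilter ℕ := hyperfilter ℕ with h𝒰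
  have h𝒰le : (𝒰 : Filter ℕ) ≤ atTop := Nat.hyperfilter_le_atTop
  -- The ultrafilter gives limits at all times at once, so no subsequence or equicontinuity argument
  -- is needed; the schemes start at 0 and hence lie in a fixed compact ball.
  have hlim : ∀ t j, ∃ z : E, 0 ≤ t → t ≤ T →
      Tendsto (fun n => W n (idx n t) j) 𝒰 (𝓝 z) := by
    intro t j
    by_cases ht : 0 ≤ t ∧ t ≤ T
    · obtain ⟨z, -, hz⟩ := (isCompact_closedBall (0:E) (C * T ^ θ)).ultrafilter_le_nhds'
        (𝒰.map fun n => W n (idx n t) j) (by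
          refine Ultrafilter.mem_map.2 (univ_mem' fun n => ?_)
          have h1 := hZH n 0 t le_rfl ht.1 ht.2 j
          have h0 : idx n 0 = 0 := by simp [hidx]
          rw [h0, (hE n).zero, sub_zero, Nat.cast_zero, mul_zero, sub_zero] at h1
          simp only [mem_preimage, mem_closedBall_zero_iff]
          refine h1.trans ?_
          have := hμ0 n
          gcongr
          exact (hidx_le n t ht.1).trans ht.2)
      exact ⟨z, fun _ _ => hz⟩
    · exact ⟨0, fun h1 h2 => absurd ⟨h1, h2⟩ ht⟩
  choose Z hZ using hlim
  set y : ℝ → E := fun t => a + ∑ j, Z t j with hy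
  have hdiff : ∀ s t, 0 ≤ s → s ≤ t → Tendsto (fun n => μ n * idx n t - μ n * idx n s) 𝒰
      (𝓝 (t - s)) := fun s t hs hst =>
    ((hidx_lim t (hs.trans hst)).sub (hidx_lim s hs)).mono_left h𝒰le
  have hpow : ∀ s t r : ℝ, 0 < r → 0 ≤ s → s ≤ t →
      Tendsto (fun n => (μ n * idx n t - μ n * idx n s) ^ r) 𝒰 (𝓝 ((t - s) ^ r)) :=
    fun s t r hr hs hst => (hdiff s t hs hst).rpow_const (Or.inr hr.le)
  have hσc : ∀ j, Continuous (σ j) := by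
    intro j
    rw [continuous_iff_continuousAt]
    intro ξ
    refine tendsto_iff_norm_sub_tendsto_zero.2 (squeeze_zero (fun _ => norm_nonneg _)
      (fun ζ => hσ j ξ ζ) ?_)
    have h1 : Continuous fun ζ : E => N * |‖ζ‖ ^ κ - ‖ξ‖ ^ κ| :=
      ((((continuous_norm.rpow_const fun _ => Or.inr hκ.le)).sub continuous_const).abs).const_mul N
    simpa using h1.tendsto ξ
  have hxlim : ∀ t, 0 ≤ t → t ≤ T → ∀ j, Tendsto (fun n => X n (idx n t) j) 𝒰 (𝓝 (x t j)) := by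
    intro t ht htT j
    refine tendsto_iff_norm_sub_tendsto_zero.2 (squeeze_zero (fun _ => norm_nonneg _)
      (g := fun n => H * (μ n) ^ θ) (fun n => ?_) ?_)
    · have h1 : min (μ n * idx n t) T = μ n * idx n t :=
        min_eq_left ((hidx_le n t ht).trans htT)
      have h0 : 0 ≤ μ n * idx n t := by have := hμ0 n; positivity
      simp only [hX]
      rw [h1, Real.norm_eq_abs]
      refine (hx t ⟨ht, htT⟩ _ ⟨h0, (hidx_le n t ht).trans htT⟩ j).trans ?_
      gcongr
      rw [abs_sub_comm, abs_of_nonneg (sub_nonneg.2 (hidx_le n t ht))]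
      linarith [hidx_lt n t]
    · have := ((hμlim.rpow_const (p := θ) (Or.inr hθ0.le)).const_mul H).mono_left h𝒰le
      simpa [Real.zero_rpow hθ0.ne'] using this
  have hylim : ∀ t, 0 ≤ t → t ≤ T → Tendsto (fun n => w n (idx n t)) 𝒰 (𝓝 (y t)) :=
    fun t ht htT => (tendsto_finsetSum _ fun j _ => hZ t j ht htT).const_add a
  refine ⟨Z, y, C, B, c, hC, hB, hc, fun j => ?_, fun t => rfl, ?_, ?_⟩
  · refine tendsto_nhds_unique (hZ 0 j le_rfl hT.le) (tendsto_const_nhds.congr fun n => ?_)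
    have h0 : idx n 0 = 0 := by simp [hidx]
    rw [h0, (hE n).zero]
  · intro s t hs hst htT j
    exact le_of_tendsto_of_tendsto
      ((hZ t j (hs.trans hst) htT).sub (hZ s j hs (hst.trans htT))).norm
      ((hpow s t θ hθ0 hs hst).const_mul C) (Eventually.of_forall fun n => hZH n s t hs hst htT j)
  · intro s t hs hst htT hys hsmall j
    have hn := (hylim s hs (hst.trans htT)).norm
    have hpos : ‖y s‖ ≠ 0 := norm_ne_zero_iff.2 hys
    have hlhs := (((hZ t j (hs.trans hst) htT).sub (hZ s j hs (hst.trans htT))).sub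
      (((hxlim t (hs.trans hst) htT j).sub (hxlim s hs (hst.trans htT) j)).smul
        ((hσc j).continuousAt.tendsto.comp (hylim s hs (hst.trans htT))))).norm
    have hrhs := (((hn.rpow_const (p := κ - 1) (Or.inl hpos)).const_mul B).mul
      (hn.rpow_const (p := κ) (Or.inl hpos))).mul
        (hpow s t (2 * θ) (by positivity) hs hst)
    refine le_of_tendsto_of_tendsto hlhs hrhs ?_
    -- The smallness condition is strict in the limit so that it passes back to the schemes, where
    -- only the non-strict form is needed.
    have e1 := (hpow s t θ hθ0 hs hst).eventually_lt
      ((hn.rpow_const (p := 1 - κ) (Or.inl hpos)).const_mul c) hsmall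
    have e2 := hn.eventually_ne hpos
    filter_upwards [e1, e2] with n h1 h2
    obtain ⟨L, hL⟩ := Nat.exists_eq_add_of_le (hidx_mono n s t hst)
    have h3 : μ n * idx n t - μ n * idx n s = μ n * L := by
      rw [hL]
      push_cast
      ring
    rw [h3] at h1
    have h4 := (hest (μ n) (n + 1) (X n) (W n) (w n) (hμ0 n) (hμn n).le (hXH n) (hE n)).2
      (idx n s) L (norm_ne_zero_iff.1 h2) h1.le j
    rw [← hL, ← h3] at h4
    exact h4

end Limit

/-! ### Hölder paths, Young integrals and Riemann sums -/

theorem isHolderOn_of_norm_sub_le {F : Type*} [NormedAddCommGroup F] {f : ℝ → F} {S : Set ℝ}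
    {r : ℝ≥0} {C : ℝ} (hC : 0 ≤ C)
    (h : ∀ u ∈ S, ∀ v ∈ S, u ≤ v → ‖f v - f u‖ ≤ C * (v - u) ^ (r : ℝ)) : IsHolderOn r f S := by
  have key : ∀ u ∈ S, ∀ v ∈ S, u ≤ v → edist (f u) (f v) ≤ C.toNNReal * edist u v ^ (r : ℝ) := by
    intro u hu v hv huv
    rw [edist_dist, edist_dist, dist_comm, dist_eq_norm, dist_comm u v, Real.dist_eq,
      abs_of_nonneg (sub_nonneg.2 huv),
      ENNReal.ofReal_rpow_of_nonneg (sub_nonneg.2 huv) r.coe_nonneg]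
    change _ ≤ ENNReal.ofReal C * _
    rw [← ENNReal.ofReal_mul hC]
    exact ENNReal.ofReal_le_ofReal (h u hu v hv huv)
  refine ⟨C.toNNReal, fun u hu v hv => ?_⟩
  rcases le_total u v with huv | hvu
  · exact key u hu v hv huv
  · rw [edist_comm, edist_comm u v]
    exact key v hv u hu hvu

theorem IsHolderOn.exists_norm_sub_le {F : Type*} [NormedAddCommGroup F] {f : ℝ → F} {S : Set ℝ}
    {r : ℝ≥0} (h : IsHolderOn r f S) :
    ∃ C : ℝ, 0 ≤ C ∧ ∀ u ∈ S, ∀ v ∈ S, ‖f v - f u‖ ≤ C * |v - u| ^ (r : ℝ) := by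
  obtain ⟨C, hC⟩ := h
  refine ⟨C, C.2, fun u hu v hv => ?_⟩
  have := hC.dist_le hv hu
  rwa [dist_eq_norm, Real.dist_eq] at this

theorem IsPartition.mono {s t : ℝ} {n : ℕ} {p : ℕ → ℝ} (hp : IsPartition s t n p) {i j : ℕ}
    (hij : i ≤ j) (hj : j ≤ n) : p i ≤ p j := by
  induction j, hij using Nat.le_induction with
  | base => exact le_rfl
  | succ j _ ih => exact (ih (by omega)).trans (hp.2.2 j (by omega)).le

/-- Each local error is at most B δ^(2θ-1) times the length of its interval, and both the increments
of `z` and the lengths telescope. -/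
theorem IsPartition.norm_sub_riemannSum_le {m : ℕ} {s t : ℝ} {n : ℕ} {p : ℕ → ℝ}
    (hp : IsPartition s t n p) {δ B θ : ℝ} (hB : 0 ≤ B) (hθ : 1 / 2 < θ)
    (hmesh : ∀ i < n, p (i + 1) - p i < δ) {z f : ℝ → EuclideanSpace ℝ (Fin m)} {x : ℝ → ℝ}
    (h : ∀ u v, s ≤ u → u ≤ v → v ≤ t → v - u < δ →
      ‖z v - z u - (x v - x u) • f u‖ ≤ B * (v - u) ^ (2 * θ)) :
    ‖z t - z s - riemannSum f x n p‖ ≤ B * δ ^ (2 * θ - 1) * (t - s) := by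
  have hz : z t - z s = ∑ i ∈ Finset.range n, (z (p (i + 1)) - z (p i)) := by
    rw [Finset.sum_range_sub (fun i => z (p i)), hp.1, hp.2.1]
  have ht : t - s = ∑ i ∈ Finset.range n, (p (i + 1) - p i) := by
    rw [Finset.sum_range_sub, hp.1, hp.2.1]
  rw [hz, riemannSum, ← Finset.sum_sub_distrib, ht, Finset.mul_sum]
  refine norm_sum_le_of_le _ fun i hi => ?_
  have hin : i < n := Finset.mem_range.1 hi
  have hlt : 0 < p (i + 1) - p i := sub_pos.2 (hp.2.2 i hin)
  have h1 : s ≤ p i := hp.1 ▸ hp.mono (Nat.zero_le i) hin.le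
  have h2 : p (i + 1) ≤ t := hp.2.1 ▸ hp.mono (show i + 1 ≤ n from hin) le_rfl
  refine (h _ _ h1 (hp.2.2 i hin).le h2 (hmesh i hin)).trans ?_
  calc B * (p (i + 1) - p i) ^ (2 * θ)
      = B * (p (i + 1) - p i) ^ (2 * θ - 1) * (p (i + 1) - p i) := by
        rw [mul_assoc, ← Real.rpow_add_one hlt.ne', sub_add_cancel]
    _ ≤ _ := by
        have := (hmesh i hin).le
        gcongr
        linarith

/-- A path `z` with the first order expansion of `∫ σ(y) dx` along a path `y` that does not vanish
is a Young integral. -/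
theorem hasYoungIntegral_of_expansion {m : ℕ} {θ : ℝ≥0} (hθ : 1 / 2 < (θ : ℝ)) {κ N C B c : ℝ}
    (hκ : 0 < κ) (hκ1 : κ < 1) (hN : 0 < N) (hC : 0 ≤ C) (hB : 0 ≤ B) (hc : 0 < c)
    {σ : EuclideanSpace ℝ (Fin m) → EuclideanSpace ℝ (Fin m)}
    (hσ : ∀ ξ ζ, ‖σ ζ - σ ξ‖ ≤ N * |‖ζ‖ ^ κ - ‖ξ‖ ^ κ|) {s t : ℝ} (hst : s ≤ t) {x : ℝ → ℝ}
    (hx : IsHolderOn θ x (Icc s t)) {y z : ℝ → EuclideanSpace ℝ (Fin m)}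
    (hne : ∀ u ∈ Icc s t, y u ≠ 0)
    (hy : ∀ u ∈ Icc s t, ∀ v ∈ Icc s t, u ≤ v → ‖y v - y u‖ ≤ C * (v - u) ^ (θ : ℝ))
    (hz : ∀ u v, s ≤ u → u ≤ v → v ≤ t → (v - u) ^ (θ : ℝ) < c * ‖y u‖ ^ (1 - κ) →
      ‖z v - z u - (x v - x u) • σ (y u)‖ ≤
        B * ‖y u‖ ^ (κ - 1) * ‖y u‖ ^ κ * (v - u) ^ (2 * (θ : ℝ))) :
    HasYoungIntegral (fun u => σ (y u)) x s t (z t - z s) := by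
  have hθ0 : (0:ℝ) < θ := by linarith
  have hθ0' : 0 < θ := by exact_mod_cast hθ0
  have hκ' : 0 < 1 - κ := by linarith
  have hcont : ContinuousOn (fun u => ‖y u‖) (Icc s t) := by
    obtain ⟨K, hK⟩ := isHolderOn_of_norm_sub_le hC hy
    exact (hK.continuousOn hθ0').norm
  have hsI : s ∈ Icc s t := left_mem_Icc.2 hst
  obtain ⟨u₀, hu₀, hmin⟩ := isCompact_Icc.exists_isMinOn ⟨s, hsI⟩ hcont
  obtain ⟨u₁, hu₁, hmax⟩ := isCompact_Icc.exists_isMaxOn ⟨s, hsI⟩ hcont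
  set r := ‖y u₀‖ with hr
  set R := ‖y u₁‖ with hR
  have hr0 : 0 < r := norm_pos_iff.2 (hne u₀ hu₀)
  have hmin' : ∀ u ∈ Icc s t, r ≤ ‖y u‖ := fun u hu => hmin hu
  have hmax' : ∀ u ∈ Icc s t, ‖y u‖ ≤ R := fun u hu => hmax hu
  refine ⟨⟨θ, θ, hθ0', hθ0', ?_, isHolderOn_of_norm_sub_le
    (C := N * (2 * r ^ (κ - 1) * C)) (by positivity) fun u hu v hv huv => ?_, hx⟩, ?_⟩
  · have : (1:ℝ) < (θ + θ : ℝ≥0) := by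
      push_cast
      linarith
    exact_mod_cast this
  · calc ‖σ (y v) - σ (y u)‖ ≤ N * |‖y v‖ ^ κ - ‖y u‖ ^ κ| := hσ _ _
      _ ≤ N * (2 * r ^ (κ - 1) * |‖y v‖ - ‖y u‖|) := by
          gcongr
          exact abs_rpow_sub_rpow_le hκ hκ1 hr0 (by linarith [hmin' u hu])
            (by linarith [hmin' v hv])
      _ ≤ N * (2 * r ^ (κ - 1) * (C * (v - u) ^ (θ : ℝ))) := by
          gcongr
          exact (abs_norm_sub_norm_le _ _).trans (hy u hu v hv huv)
      _ = _ := by ring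
  · intro ε hε
    -- With the norm of `y` between `r` and `R`, both the constant and the range of validity of the
    -- expansion become uniform on [s,t].
    set K := B * r ^ (κ - 1) * R ^ κ with hK
    have hR0 : 0 ≤ R := norm_nonneg _
    have hK0 : 0 ≤ K := by positivity
    have h2θ : 0 < 2 * (θ : ℝ) - 1 := by linarith
    have hev : ∀ᶠ δ : ℝ in 𝓝[>] 0, K * δ ^ (2 * (θ : ℝ) - 1) * (t - s) < ε ∧
        δ ^ (θ : ℝ) < c * r ^ (1 - κ) ∧ 0 < δ := by
      have hp : ∀ e : ℝ, 0 < e → Tendsto (fun δ : ℝ => δ ^ e) (𝓝[>] 0) (𝓝 0) := by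
        intro e he
        have := (Real.continuousAt_rpow_const (0:ℝ) e (Or.inr he.le)).tendsto
        rw [Real.zero_rpow he.ne'] at this
        exact this.mono_left nhdsWithin_le_nhds
      have h1 := ((hp _ h2θ).const_mul K).mul_const (t - s)
      rw [mul_zero, zero_mul] at h1
      exact (h1.eventually_lt_const hε).and
        (((hp _ hθ0).eventually_lt_const (by positivity)).and self_mem_nhdsWithin)
    obtain ⟨δ, hδε, hδr, hδ0⟩ := hev.exists
    refine ⟨δ, hδ0, fun n p hp hmesh => ?_⟩
    refine (hp.norm_sub_riemannSum_le hK0 hθ hmesh fun u v hu huv hv hvu => ?_).trans hδε.le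
    have huI : u ∈ Icc s t := ⟨hu, huv.trans hv⟩
    refine (hz u v hu huv hv ?_).trans ?_
    · calc (v - u) ^ (θ : ℝ) ≤ δ ^ (θ : ℝ) :=
            Real.rpow_le_rpow (sub_nonneg.2 huv) hvu.le hθ0.le
        _ < c * r ^ (1 - κ) := hδr
        _ ≤ _ := by
            gcongr
            exact hmin' u huI
    · have h1 : ‖y u‖ ^ (κ - 1) ≤ r ^ (κ - 1) :=
        Real.rpow_le_rpow_of_nonpos hr0 (hmin' u huI) (by linarith)
      have h2 : ‖y u‖ ^ κ ≤ R ^ κ := Real.rpow_le_rpow (norm_nonneg _) (hmax' u huI) hκ.le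
      have h3 : 0 ≤ v - u := sub_nonneg.2 huv
      rw [hK]
      gcongr

/-- A fine partition of `[s, u]`, followed by the single interval `[u, τ]` and a fine partition
of `[τ, t]`. -/
theorem exists_partition_through {s u τ t δ₁ δ₂ : ℝ} (hsu : s < u) (huτ : u < τ) (hτt : τ ≤ t)
    (hδ₁ : 0 < δ₁) (hδ₂ : 0 < δ₂) :
    ∃ (K n : ℕ) (p : ℕ → ℝ), IsPartition s t n p ∧ IsPartition s u K p ∧ K < n ∧
      p (K + 1) = τ ∧ (∀ i < K, p (i + 1) - p i < δ₁) ∧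
      ∀ i < n, K < i → p (i + 1) - p i < δ₂ := by
  obtain ⟨K, hK⟩ := exists_nat_gt ((u - s) / δ₁)
  have hK0 : (0:ℝ) < K := lt_of_le_of_lt (div_nonneg (by linarith) hδ₁.le) hK
  -- For t = τ there are no intervals on the right: Q = 0, and division by zero gives the harmless
  -- length 0.
  obtain ⟨Q, hQ0, hQ⟩ : ∃ Q : ℕ, (0 < Q → τ < t) ∧ τ + Q * ((t - τ) / Q) = t ∧
      (t - τ) / Q < δ₂ := by
    rcases hτt.eq_or_lt with rfl | h
    · exact ⟨0, by simp, by simp, by simpa⟩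
    · obtain ⟨Q, hQ⟩ := exists_nat_gt ((t - τ) / δ₂)
      have hQ0 : (0:ℝ) < Q := lt_of_le_of_lt (div_nonneg (by linarith) hδ₂.le) hQ
      refine ⟨Q, fun _ => h, ?_, ?_⟩
      · field_simp
        ring
      · rw [div_lt_iff₀ hδ₂] at hQ
        rw [div_lt_iff₀ hQ0]
        linarith
  obtain ⟨hQt, hQδ⟩ := hQ
  set p : ℕ → ℝ := fun i => if i ≤ K then s + i * ((u - s) / K)
    else τ + ((i : ℝ) - K - 1) * ((t - τ) / Q) with hp
  have hpl : ∀ i ≤ K, p i = s + i * ((u - s) / K) := fun i hi => if_pos hi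
  have hpr : ∀ i, K < i → p i = τ + ((i : ℝ) - K - 1) * ((t - τ) / Q) := fun i hi =>
    if_neg (not_le.2 hi)
  have hp0 : p 0 = s := by rw [hpl 0 (Nat.zero_le _)]; simp
  have hpK : p K = u := by
    rw [hpl K le_rfl]
    field_simp
    ring
  have hpK1 : p (K + 1) = τ := by
    rw [hpr _ (Nat.lt_succ_self K)]
    push_cast
    ring
  have hdl : ∀ i < K, p (i + 1) - p i = (u - s) / K := fun i hi => by
    rw [hpl _ hi, hpl _ hi.le]
    push_cast
    ring
  have hdr : ∀ i, K < i → p (i + 1) - p i = (t - τ) / Q := fun i hi => by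
    rw [hpr _ hi, hpr _ (hi.trans (Nat.lt_succ_self i))]
    push_cast
    ring
  have hincl : ∀ i < K, p i < p (i + 1) := fun i hi => by
    rw [← sub_pos, hdl i hi]
    exact div_pos (by linarith) hK0
  refine ⟨K, K + 1 + Q, p, ⟨hp0, ?_, fun i hi => ?_⟩, ⟨hp0, hpK, hincl⟩, by omega, hpK1,
    fun i hi => ?_, fun i _ hi => ?_⟩
  · rw [hpr _ (by omega)]
    refine Eq.trans ?_ hQt
    push_cast
    ring
  · rcases lt_trichotomy i K with h | rfl | h
    · exact hincl i h
    · rw [hpK, hpK1]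
      exact huτ
    · have hQ1 : 0 < Q := by omega
      rw [← sub_pos, hdr i h]
      exact div_pos (by linarith [hQ0 hQ1]) (by exact_mod_cast hQ1)
  · rw [hdl i hi, div_lt_iff₀ hK0]
    rw [div_lt_iff₀ hδ₁] at hK
    linarith
  · rw [hdr i hi]
    exact hQδ

/-- Riemann sums along partitions through `τ`, for integrands that vanish from the time `τ` on. -/
theorem hasRiemannSumIntegrals_of_vanishing {m d : ℕ} {γ : ℝ≥0} (hγ : 0 < γ) {c L s τ t : ℝ}
    (hc : 0 < c) (hLc : 2 * L * c ^ (γ : ℝ) ≤ 1) (hsτ : s < τ) (hτt : τ ≤ t)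
    {f : Fin d → ℝ → EuclideanSpace ℝ (Fin m)} {x : ℝ → EuclideanSpace ℝ (Fin d)}
    {Z : ℝ → Fin d → EuclideanSpace ℝ (Fin m)}
    (hf : ∀ j u, τ ≤ u → f j u = 0)
    (hY : ∀ j u, s < u → u < τ → HasYoungIntegral (f j) (fun v => x v j) s u (Z u j - Z s j))
    (hL : ∀ j u, s < u → u < τ → τ - u ≤ 1 →
      ‖Z τ j - Z u j - (x τ j - x u j) • f j u‖ ≤ L * (τ - u) ^ (γ : ℝ)) :
    HasRiemannSumIntegrals γ c τ f x s t (fun j => Z τ j - Z s j) := by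
  have hγ0 : (0:ℝ) < γ := by exact_mod_cast hγ
  have hmin : 0 < min 1 (τ - s) := lt_min one_pos (sub_pos.2 hsτ)
  -- The threshold for ε is exactly the one that forces η < min 1 (τ - s).
  refine ⟨(min 1 (τ - s) / c) ^ (γ : ℝ), by positivity, fun ε hε hε₀ δ hδ => ?_⟩
  set η := c * ε ^ (1 / (γ : ℝ)) with hη
  have hη0 : 0 < η := by positivity
  have hηγ : η ^ (γ : ℝ) = c ^ (γ : ℝ) * ε := by
    rw [hη, Real.mul_rpow hc.le (by positivity), ← Real.rpow_mul hε.le,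
      one_div_mul_cancel hγ0.ne', Real.rpow_one]
  have hηmin : η < min 1 (τ - s) := by
    have h1 : ε ^ (1 / (γ : ℝ)) < min 1 (τ - s) / c := by
      have h2 := Real.rpow_lt_rpow hε.le hε₀ (one_div_pos.2 hγ0)
      rwa [← Real.rpow_mul (by positivity), mul_one_div_cancel hγ0.ne', Real.rpow_one] at h2
    rw [lt_div_iff₀ hc] at h1
    linarith
  have hη1 : η < 1 := hηmin.trans_le (min_le_left _ _)
  have hηs : η < τ - s := hηmin.trans_le (min_le_right _ _)
  set u := τ - η with hu
  have hsu : s < u := by linarith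
  have huτ : u < τ := by linarith
  have hδ' : ∃ δ' : ℝ, 0 < δ' ∧ δ' ≤ δ ∧ ∀ j (n : ℕ) (p : ℕ → ℝ), IsPartition s u n p →
      (∀ i < n, p (i + 1) - p i < δ') →
        ‖Z u j - Z s j - riemannSum (f j) (fun v => x v j) n p‖ ≤ ε / 2 := by
    choose D hD0 hD using fun j => (hY j u hsu huτ).2 (ε / 2) (by positivity)
    have hev : ∀ᶠ δ' : ℝ in 𝓝[>] 0, 0 < δ' ∧ δ' < δ ∧ ∀ j, δ' < D j := by
      refine Eventually.and self_mem_nhdsWithin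
        (((eventually_lt_nhds hδ).and ?_).filter_mono nhdsWithin_le_nhds)
      exact eventually_all.2 fun j => eventually_lt_nhds (hD0 j)
    obtain ⟨δ', h0, h1, h2⟩ := hev.exists
    exact ⟨δ', h0, h1.le, fun j n p hp hmesh =>
      hD j n p hp fun i hi => (hmesh i hi).trans (h2 j)⟩
  obtain ⟨δ', hδ'0, hδ'δ, hsum⟩ := hδ'
  obtain ⟨K, n, p, hp, hpK, hKn, hpτ, hmesh₁, hmesh₂⟩ :=
    exists_partition_through hsu huτ hτt hδ'0 hδ
  have hτu : |τ - p K| = η := by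
    rw [hpK.2.1, hu, sub_sub_cancel, abs_of_pos hη0]
  refine ⟨n, p, K, ⟨hp, hKn, hpK.2.1 ▸ huτ, hpτ.ge, hτu.ge, ?_⟩, fun i hi hiK => ?_, fun j => ?_⟩
  · rw [hτu]
    linarith
  · rcases lt_or_gt_of_ne hiK with h | h
    · exact (hmesh₁ i h).trans_le hδ'δ
    · exact hmesh₂ i hi h
  -- Intervals starting at τ or later contribute nothing. The fine part on [s,u] and the single
  -- interval [u,τ] cost ε/2 each.
  · have hsplit : riemannSum (f j) (fun v => x v j) n p =
        riemannSum (f j) (fun v => x v j) K p + (x τ j - x u j) • f j u := by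
      obtain ⟨Q, rfl⟩ := Nat.exists_eq_add_of_lt hKn
      rw [riemannSum, riemannSum, show K + Q + 1 = K + 1 + Q by omega, Finset.sum_range_add,
        Finset.sum_range_succ, hpτ, hpK.2.1, add_eq_left]
      refine Finset.sum_eq_zero fun i hi => ?_
      have hiQ : i < Q := Finset.mem_range.1 hi
      rw [hf j (p (K + 1 + i)) (hpτ ▸ hp.mono (by omega) (by omega)), smul_zero]
    have h1 := hsum j K p hpK hmesh₁
    have h2 := hL j u hsu huτ (by linarith)
    have h3 : L * (τ - u) ^ (γ : ℝ) ≤ ε / 2 := by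
      rw [hu, sub_sub_cancel, hηγ]
      nlinarith
    rw [hsplit]
    calc _ = ‖(Z u j - Z s j - riemannSum (f j) (fun v => x v j) K p) +
          (Z τ j - Z u j - (x τ j - x u j) • f j u)‖ := by
          congr 1
          module
      _ ≤ ε / 2 + ε / 2 := norm_add_le_of_le h1 (h2.trans h3)
      _ = ε := add_halves ε

/-! ### The solution and its first zero -/

theorem exists_common_power_bound {m d : ℕ} {γ : ℝ≥0} {κ : ℝ}
    {σ : Fin d → EuclideanSpace ℝ (Fin m) → EuclideanSpace ℝ (Fin m)}
    (hσ : ∀ j, IsPowerDominated γ κ (σ j)) :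
    ∃ N : ℝ, 0 < N ∧ ∀ j ξ ζ, ‖σ j ζ - σ j ξ‖ ≤ N * |‖ζ‖ ^ κ - ‖ξ‖ ^ κ| := by
  choose N hN using fun j => (hσ j).bound
  refine ⟨1 + ∑ j, |N j|, by positivity, fun j ξ ζ => (hN j ξ ζ).trans ?_⟩
  gcongr
  have := Finset.single_le_sum (f := fun j => |N j|) (fun j _ => abs_nonneg _) (Finset.mem_univ j)
  linarith [le_abs_self (N j)]

theorem mainTheorem4 {m d : ℕ} (T : ℝ) (hT : 0 < T) (γ : ℝ≥0) (hγ : 1 / 2 < γ) (κ : ℝ)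
    (hγκ : 1 < (γ : ℝ) + κ)
    (σ : Fin d → EuclideanSpace ℝ (Fin m) → EuclideanSpace ℝ (Fin m))
    (hσ : ∀ j, IsPowerLike γ κ (σ j))
    (x : ℝ → EuclideanSpace ℝ (Fin d))
    (hx : ∃ ε₁ : ℝ≥0, 0 < ε₁ ∧ IsHolderOn (γ + ε₁) x (Icc 0 T) ∧
      ((γ + ε₁ : ℝ≥0) : ℝ) + γ * κ < 1)
    (hrough : ∃ ε' : ℝ, 0 < ε' ∧ IsHolderRough T (γ + ε') x)
    (a : EuclideanSpace ℝ (Fin m)) (ha : a ≠ 0) :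
    ∃ (y : ℝ → EuclideanSpace ℝ (Fin m)) (τ : ℝ), ContinuousOn y (Icc 0 T) ∧ τ ≤ T ∧
      ((τ = T ∧ (∀ t ∈ Icc 0 T, y t ≠ 0) ∧ IsHolderOn γ y (Icc 0 T) ∧
          IsYoungSolution σ x a T y) ∨
        (0 < τ ∧ IsHolderOn γ y (Icc 0 T) ∧ IsRiemannSumSolution γ σ x a T τ y ∧
          (∀ s ∈ Ico 0 τ, y s ≠ 0) ∧ Tendsto y (𝓝[<] τ) (𝓝 0) ∧
          ∀ t ∈ Icc τ T, y t = 0)) := by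
  -- Without driving paths the constant path solves the equation; otherwise any one coefficient
  -- supplies the bounds on κ.
  rcases isEmpty_or_nonempty (Fin d) with hd | ⟨⟨j₀⟩⟩
  · refine ⟨fun _ => a, T, continuousOn_const, le_rfl, Or.inl ⟨rfl, fun _ _ => ha,
      isHolderOn_of_norm_sub_le le_rfl fun u _ v _ _ => by simp, fun t _ => ⟨fun _ => 0,
      fun j => hd.elim j, by simp⟩⟩⟩
  obtain ⟨ε₁, -, hx, -⟩ := hx
  have hκ := (hσ j₀).kappa_pos
  have hκ1 := (hσ j₀).kappa_lt_one
  have hγ' : 1 / 2 < (γ : ℝ) := by exact_mod_cast hγ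
  have hγ0 : 0 < γ := by
    have : (0:ℝ) < γ := by linarith
    exact_mod_cast this
  set θ : ℝ≥0 := γ + ε₁ with hθdef
  have hγθ : (γ : ℝ) ≤ θ := by
    rw [hθdef, NNReal.coe_add]
    linarith [ε₁.coe_nonneg]
  have hθ : 1 / 2 < (θ : ℝ) := by linarith
  have hθ0 : (0:ℝ) < θ := by linarith
  obtain ⟨N, hN, hσN⟩ := exists_common_power_bound fun j => (hσ j).toIsPowerDominated
  have hσ0 : ∀ j, σ j 0 = 0 := fun j => (hσ j).map_zero
  obtain ⟨H, hH, hxH⟩ := hx.exists_norm_sub_le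
  have hxH' : ∀ s ∈ Icc 0 T, ∀ t ∈ Icc 0 T, ∀ j, |x t j - x s j| ≤ H * |t - s| ^ (θ : ℝ) :=
    fun s hs t ht j => (PiLp.norm_apply_le (x t - x s) j).trans (hxH s hs t ht)
  obtain ⟨Z, y, C, B, c, hC, hB, hc, hZ0, hy, hZ, hloc⟩ := exists_limit_of_euler_schemes hH hθ hκ
    hκ1 (by linarith) hN hT hσ0 hσN a (fun t j => x t j) hxH'
  have hy0 : y 0 = a := by simp [hy, hZ0]
  have hysub : ∀ s t, y t - y s = ∑ j, (Z t j - Z s j) := fun s t => by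
    rw [hy, hy, add_sub_add_left_eq_sub, Finset.sum_sub_distrib]
  have hyH : ∀ s t, 0 ≤ s → s ≤ t → t ≤ T → ‖y t - y s‖ ≤ d * C * (t - s) ^ (θ : ℝ) := by
    intro s t hs hst htT
    rw [hysub]
    refine (norm_sum_le_of_le _ fun j _ => hZ s t hs hst htT j).trans (le_of_eq ?_)
    simp
    ring
  have hdC : 0 ≤ d * C := by positivity
  have hxj : ∀ j s t, 0 ≤ s → t ≤ T → IsHolderOn θ (fun u => x u j) (Icc s t) :=
    fun j s t hs ht => isHolderOn_of_norm_sub_le hH fun u hu v hv huv => by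
      have := hxH' u ⟨hs.trans hu.1, hu.2.trans ht⟩ v ⟨hs.trans hv.1, hv.2.trans ht⟩ j
      rwa [abs_of_nonneg (sub_nonneg.2 huv)] at this
  -- Hölder continuity of order `θ` implies Hölder continuity of order `γ`
  have hγHolder : ∀ w : ℝ → EuclideanSpace ℝ (Fin m), (∀ u ∈ Icc 0 T, ∀ v ∈ Icc 0 T, u ≤ v →
      ‖w v - w u‖ ≤ d * C * (v - u) ^ (θ : ℝ)) → IsHolderOn γ w (Icc 0 T) := by
    intro w hw
    refine isHolderOn_of_norm_sub_le (C := d * C * T ^ ((θ : ℝ) - γ)) (by positivity)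
      fun u hu v hv huv => (hw u hu v hv huv).trans ?_
    have h1 : 0 ≤ v - u := sub_nonneg.2 huv
    calc d * C * (v - u) ^ (θ : ℝ)
        = d * C * ((v - u) ^ ((θ : ℝ) - γ) * (v - u) ^ (γ : ℝ)) := by
          rw [← Real.rpow_add_of_nonneg h1 (by linarith) γ.coe_nonneg, sub_add_cancel]
      _ ≤ d * C * (T ^ ((θ : ℝ) - γ) * (v - u) ^ (γ : ℝ)) := by
          gcongr
          linarith [hv.2, hu.1]
      _ = _ := by ring
  have hcontOf : ∀ w : ℝ → EuclideanSpace ℝ (Fin m), IsHolderOn γ w (Icc 0 T) →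
      ContinuousOn w (Icc 0 T) := fun w hw => by
    obtain ⟨K, hK⟩ := hw
    exact hK.continuousOn hγ0
  -- away from its zeros `y` is a Young solution
  have hYoung : ∀ (w : ℝ → EuclideanSpace ℝ (Fin m)) (s t : ℝ), 0 ≤ s → s ≤ t → t ≤ T →
      (∀ u ∈ Icc s t, w u = y u ∧ y u ≠ 0) → ∀ j,
      HasYoungIntegral (fun u => σ j (w u)) (fun u => x u j) s t (Z t j - Z s j) := by
    intro w s t hs hst htT hw j
    refine hasYoungIntegral_of_expansion (z := fun u => Z u j) hθ hκ hκ1 hN hdC hB hc (hσN j) hst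
      (hxj j s t hs htT) (fun u hu => (hw u hu).1 ▸ (hw u hu).2) (fun u hu v hv huv => ?_)
      fun u v hu huv hv hsmall => ?_
    · rw [(hw u hu).1, (hw v hv).1]
      exact hyH u v (hs.trans hu.1) huv (hv.2.trans htT)
    · obtain ⟨h1, h2⟩ := hw u ⟨hu, huv.trans hv⟩
      rw [h1] at hsmall ⊢
      exact hloc u v (hs.trans hu) huv (hv.trans htT) h2 hsmall j
  have hsol : ∀ (w : ℝ → EuclideanSpace ℝ (Fin m)) (S : ℝ), S ≤ T →
      (∀ u ∈ Icc 0 S, w u = y u ∧ y u ≠ 0) → IsYoungSolution σ x a S w := by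
    intro w S hS hw t ht
    refine ⟨fun j => Z t j, fun j => ?_, by rw [(hw t ht).1, hy]⟩
    have := hYoung w 0 t le_rfl ht.1 (ht.2.trans hS) (fun u hu => hw u ⟨hu.1, hu.2.trans ht.2⟩) j
    rwa [hZ0, sub_zero] at this
  have hyγ : IsHolderOn γ y (Icc 0 T) := hγHolder y fun u hu v hv huv => hyH u v hu.1 huv hv.2
  by_cases hzero : ∀ t ∈ Icc 0 T, y t ≠ 0
  · exact ⟨y, T, hcontOf y hyγ, le_rfl, Or.inl ⟨rfl, hzero, hyγ,
      hsol y T le_rfl fun u hu => ⟨rfl, hzero u hu⟩⟩⟩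
  -- the first zero of `y`
  obtain ⟨τ, hτ, hτmin⟩ : ∃ τ ∈ {t ∈ Icc 0 T | y t = 0}, ∀ t ∈ {t ∈ Icc 0 T | y t = 0}, τ ≤ t := by
    have hcl : IsClosed {t ∈ Icc 0 T | y t = 0} :=
      (hcontOf y hyγ).preimage_isClosed_of_isClosed isClosed_Icc isClosed_singleton
    have hne : {t ∈ Icc 0 T | y t = 0}.Nonempty := by
      push Not at hzero
      exact hzero
    have hbdd : BddBelow {t ∈ Icc 0 T | y t = 0} := ⟨0, fun t ht => ht.1.1⟩
    exact ⟨_, hcl.csInf_mem hne hbdd, fun t ht => csInf_le hbdd ht⟩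
  obtain ⟨⟨hτ0', hτT⟩, hyτ⟩ := hτ
  have hτ0 : 0 < τ := by
    refine lt_of_le_of_ne hτ0' fun h => ha ?_
    rw [← hy0, h, hyτ]
  have hyne : ∀ t, 0 ≤ t → t < τ → y t ≠ 0 := fun t ht htτ h =>
    absurd (hτmin t ⟨⟨ht, htτ.le.trans hτT⟩, h⟩) (not_le.2 htτ)
  set w : ℝ → EuclideanSpace ℝ (Fin m) := fun t => if t < τ then y t else 0 with hwdef
  have hwl : ∀ t, t < τ → w t = y t := fun t ht => if_pos ht
  have hwr : ∀ t, τ ≤ t → w t = 0 := fun t ht => if_neg (not_lt.2 ht)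
  have hwH : ∀ u ∈ Icc 0 T, ∀ v ∈ Icc 0 T, u ≤ v →
      ‖w v - w u‖ ≤ d * C * (v - u) ^ (θ : ℝ) := by
    intro u hu v hv huv
    rcases lt_or_ge v τ with hvτ | hvτ
    · rw [hwl v hvτ, hwl u (huv.trans_lt hvτ)]
      exact hyH u v hu.1 huv hv.2
    rcases lt_or_ge u τ with huτ | huτ
    · rw [hwr v hvτ, hwl u huτ, ← hyτ]
      refine (hyH u τ hu.1 huτ.le hτT).trans ?_
      have : 0 ≤ τ - u := by linarith
      gcongr
    · rw [hwr v hvτ, hwr u huτ, sub_zero, norm_zero]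
      have : 0 ≤ v - u := sub_nonneg.2 huv
      positivity
  have hwγ := hγHolder w hwH
  have hwcont := hcontOf w hwγ
  refine ⟨w, τ, hwcont, hτT, Or.inr ⟨hτ0, hwγ, ⟨fun t _ htτ => ?_, ?_⟩, fun s hs => ?_, ?_,
    fun t ht => hwr t ht.1⟩⟩
  · exact hsol w t (htτ.le.trans hτT) fun u hu =>
      ⟨hwl u (hu.2.trans_lt htτ), hyne u hu.1 (hu.2.trans_lt htτ)⟩
  -- `C` bounds the increment of `Z` over [u,τ]. The rest bounds the Riemann term, since y τ = 0 and
  -- τ - u ≤ 1 give a norm of at most d C at time `u`.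
  · set L := C + N * (d * C) ^ κ * H with hL
    have hL0 : 0 ≤ L := by positivity
    have hγ0' : (0:ℝ) < γ := by linarith
    -- Chosen so that 2 L c^γ = L/(L+1) ≤ 1; it does not depend on `s` and `t`. The integral ends at
    -- τ because the frozen path makes no increment afterwards.
    refine ⟨(1 / (2 * (L + 1))) ^ (1 / (γ : ℝ)), by positivity, fun s t hs hsτ hτt htT =>
      ⟨fun j => Z τ j - Z s j, hasRiemannSumIntegrals_of_vanishing hγ0 (L := L) (by positivity) ?_
        hsτ hτt (fun j u hu => ?_) (fun j u hsu huτ => ?_) fun j u hsu huτ hu1 => ?_, ?_⟩⟩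
    · rw [← Real.rpow_mul (by positivity), one_div_mul_cancel hγ0'.ne', Real.rpow_one,
        mul_one_div, div_le_one (by positivity)]
      linarith
    · rw [hwr u hu, hσ0]
    · exact hYoung w s u hs hsu.le (huτ.le.trans hτT) (fun v hv =>
        ⟨hwl v (hv.2.trans_lt huτ), hyne v (hs.trans hv.1) (hv.2.trans_lt huτ)⟩) j
    · have hu0 : 0 ≤ u := hs.trans hsu.le
      have hη : 0 < τ - u := sub_pos.2 huτ
      have h1 := hZ u τ hu0 huτ.le hτT j
      have h2 : ‖w u‖ ≤ d * C := by
        have h3 := hyH u τ hu0 huτ.le hτT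
        rw [hyτ, zero_sub, norm_neg, ← hwl u huτ] at h3
        exact h3.trans (mul_le_of_le_one_right hdC (Real.rpow_le_one hη.le hu1 hθ0.le))
      have h4 : ‖(x τ j - x u j) • σ j (w u)‖ ≤
          H * (τ - u) ^ (θ : ℝ) * (N * (d * C) ^ κ) := by
        rw [norm_smul, Real.norm_eq_abs]
        have h5 := hxH' u ⟨hu0, huτ.le.trans hτT⟩ τ ⟨hτ0', hτT⟩ j
        rw [abs_of_pos hη] at h5
        refine mul_le_mul h5 ?_ (norm_nonneg _) (by positivity)
        refine (norm_le_of_power_bound hσ0 hκ hσN j _).trans ?_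
        gcongr
      calc _ ≤ C * (τ - u) ^ (θ : ℝ) + H * (τ - u) ^ (θ : ℝ) * (N * (d * C) ^ κ) :=
            norm_sub_le_of_le h1 h4
        _ = L * (τ - u) ^ (θ : ℝ) := by
            rw [hL]
            ring
        _ ≤ L * (τ - u) ^ (γ : ℝ) :=
            mul_le_mul_of_nonneg_left (Real.rpow_le_rpow_of_exponent_ge hη hu1 hγθ) hL0
    · rw [hwr t hτt, hwl s hsτ, ← hyτ, hysub]
  · rw [hwl s hs.2]
    exact hyne s hs.1 hs.2
  · have h1 := (hwcont τ ⟨hτ0', hτT⟩).tendsto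
    rw [hwr τ le_rfl] at h1
    exact h1.mono_left (nhdsWithin_le_iff.2
      (mem_of_superset (Icc_mem_nhdsLT hτ0) (Icc_subset_Icc_right hτT)))
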